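/- Game R on a finite connected graph $G$ with nonnegative vertex weights: Alice and Bob alternately take one vertex of $G$ each, Alice first, until all vertices are taken, so that the subgraph induced by the remaining vertices is connected during the whole game. Alice's gain is the largest total weight that she has a strategy to obtain. A graph is even if it has an even number of vertices. All weighted graphs below are connected and have positive total weight. For $r\ge 0$, let $\nabla_r(G)$ be the maximum of $|E(H)|/|V(H)|$ over all nonempty graphs $H$ such that there are pairwise disjoint vertex sets $B_x\subseteq V(G)$, $x\in V(H)$, each inducing a connected subgraph of $G$ of radius at most $r$, with an edge of $G$ between $B_x$ and $B_y$ whenever $xy\in E(H)$. A class $\mathcal G$ has bounded expansion if for each $r$, $\nabla_r(G)$ is bounded over $G\in\mathcal G$. It has bounded local expansion if for all $\rho,r\ge 0$, $\nabla_r$ is bounded over all subgraphs of graphs $G\in\mathcal G$ induced by the balls of radius $\rho$ around the vertices of $G$. **Theorem.** For every $\varepsilon>0$ and every $g$ there is a $\{0,1\}$-weighted even graph $G$ that contains a cycle, has girth at least $g$, and on which Bob has a strategy in game R to obtain at least $(1-4\varepsilon)$ of the total weight of the vertices. Moreover: (1) There is a function $D$ with $D(\varepsilon)=O\left(\frac1\varepsilon\log\frac1\varepsilon\right)$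 as $\varepsilon\to 0^+$ such that for every $\varepsilon>0$ there is an infinite class $\mathcal G_\varepsilon$ (containing graphs of arbitrarily large order) of $\{0,1\}$-weighted even graphs of maximum degree at most $D(\varepsilon)$, on each of which Bob has a strategy in game R to obtain at least $(1-4\varepsilon)$ of the total weight, and which contains, for every $g$, a graph with a cycle and of girth at least $g$. Moreover, $\mathcal G_\varepsilon$ has bounded expansion. (2) There is a class $\mathcal G$ of $\{0,1\}$-weighted even graphs with bounded local expansion for which the infimum, over $G\in\mathcal G$, of the ratio of Alice's gain in game R on $G$ to the total weight of $G$ is $0$. -/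

import Mathlib

open Filter Topology Asymptotics

/-- A finite connected graph with nonnegative weights assigned to its vertices. -/
structure WeightedGraph where
  V : Type
  [fintypeV : Fintype V]
  graph : SimpleGraph V
  connected : graph.Connected
  weight : V → ℝ
  weight_nonneg : ∀ v, 0 ≤ weight v

attribute [instance] WeightedGraph.fintypeV

namespace WeightedGraph

/-- The number of vertices. -/
def order (A : WeightedGraph) : ℕ := Fintype.card A.V

/-- The total weight of the vertices. -/
noncomputable def totalWeight (A : WeightedGraph) : ℝ := ∑ v, A.weight v

/-- All the weights are `0` or `1`. -/
def IsZeroOne (A : WeightedGraph) : Prop := ∀ v, A.weight v = 0 ∨ A.weight v = 1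

open Classical in
/-- The maximum degree of the underlying graph. -/
noncomputable def maxDegree (A : WeightedGraph) : ℕ := A.graph.maxDegree

end WeightedGraph

/-! ### Game R -/

/-- The two players. -/
inductive Player where
  | alice
  | bob

/-- The player who takes the vertex with index `k` (counting from `0`): Alice moves first and the
players alternate. -/
def mover (k : ℕ) : Player := if Even k then Player.alice else Player.bob

namespace WeightedGraph

/-- A history of game R: the list of the vertices taken so far, in the order in which they were
taken. They are distinct, and at each moment the subgraph induced by the remaining vertices is
connected (the empty graph, reached at the end of the game, being allowed). -/
def IsHistory (A : WeightedGraph) (h : List A.V) : Prop :=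
  h.Nodup ∧ ∀ k ≤ h.length, (A.graph.induce {v | v ∉ h.take k}).Preconnected

/-- All the vertices have been taken. -/
def IsComplete (A : WeightedGraph) (h : List A.V) : Prop := ∀ v, v ∈ h

/-- In the history `h`, player `p` has made all of his or her moves according to the strategy `σ`,
which maps each history to the next vertex to be taken. -/
def Follows (A : WeightedGraph) (p : Player) (σ : List A.V → A.V) (h : List A.V) : Prop :=
  ∀ k : Fin h.length, mover k = p → h.get k = σ (h.take k)

/-- The total weight of the vertices taken by player `p` in the history `h`. -/
noncomputable def gain (A : WeightedGraph) (p : Player) (h : List A.V) : ℝ :=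
  open Classical in ∑ k : Fin h.length, if mover k = p then A.weight (h.get k) else 0

/-- `σ` is a valid strategy of player `p` in game R: as long as `p` follows it, it tells `p` to make
a move that is allowed. -/
def IsStrategy (A : WeightedGraph) (p : Player) (σ : List A.V → A.V) : Prop :=
  ∀ h, A.IsHistory h → A.Follows p σ h → mover h.length = p → ¬ A.IsComplete h →
    A.IsHistory (h ++ [σ h])

/-- Player `p` has a strategy in game R to obtain weight at least `x`, however the other player
plays. -/
def Secures (A : WeightedGraph) (p : Player) (x : ℝ) : Prop :=
  ∃ σ, A.IsStrategy p σ ∧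
    ∀ h, A.IsHistory h → A.Follows p σ h → A.IsComplete h → x ≤ A.gain p h

/-- Alice's gain in game R: the largest weight that she can secure. -/
noncomputable def aliceGain (A : WeightedGraph) : ℝ := sSup {x | A.Secures Player.alice x}

end WeightedGraph

/-! ### Bounded expansion and bounded local expansion -/

/-- `H` is a shallow minor of `G` at depth `r`: the vertices of `H` correspond to pairwise disjoint
sets of vertices of `G`, each inducing a connected subgraph of radius at most `r`, and adjacent
vertices of `H` correspond to sets joined by an edge of `G`. -/
def IsShallowMinor {W V : Type} (r : ℕ) (H : SimpleGraph W) (G : SimpleGraph V) : Prop :=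
  ∃ B : W → Set V,
    (∀ i, ∃ c : B i, ∀ x : B i, (G.induce (B i)).edist c x ≤ r) ∧
    (∀ i j, i ≠ j → Disjoint (B i) (B j)) ∧
    (∀ i j, H.Adj i j → ∃ x ∈ B i, ∃ y ∈ B j, G.Adj x y)

/-- The greatest reduced average density `∇_r(G)` (the supremum of `|E(H)| / |V(H)|` over the finite
nonempty shallow minors `H` of `G` at depth `r`) is at most `c`. -/
def GradLE {V : Type} (r : ℕ) (G : SimpleGraph V) (c : ℝ) : Prop :=
  ∀ (m : ℕ) (H : SimpleGraph (Fin m)), 0 < m → IsShallowMinor r H G →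
    (H.edgeSet.ncard : ℝ) / m ≤ c

/-- The ball of radius `ρ` around `v` in `G`, as an induced subgraph. -/
abbrev ballGraph {V : Type} (G : SimpleGraph V) (ρ : ℕ) (v : V) :
    SimpleGraph {u : V | G.edist v u ≤ ρ} :=
  G.induce {u : V | G.edist v u ≤ ρ}

/-- A class has bounded expansion if, for each `r`, `∇_r` is bounded on it. -/
def HasBoundedExpansion (𝒢 : Set WeightedGraph) : Prop :=
  ∃ f : ℕ → ℝ, ∀ A ∈ 𝒢, ∀ r, GradLE r A.graph (f r)

/-- A class has bounded local expansion if, for each `ρ` and `r`, `∇_r` is bounded on the balls of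
radius `ρ` in the graphs of the class. -/
def HasBoundedLocalExpansion (𝒢 : Set WeightedGraph) : Prop :=
  ∃ f : ℕ → ℕ → ℝ, ∀ A ∈ 𝒢, ∀ (ρ r : ℕ) (v : A.V), GradLE r (ballGraph A.graph ρ v) (f ρ r)

/-! Bob plays on the corona of a sparse graph `H` in which any two sets of `k` vertices are joined
by an edge (`Joined`), with weight `1` on the core and `0` on the leaves. Call a core vertex guarded
while its leaf is present. As long as core vertices remain afterwards, a core vertex can be taken
only if it is unguarded and not a cut vertex of the remaining core `R`.

Each move changes the number of unguarded vertices in `R` by one, so this number is odd when Bob is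
to move. If Alice has just taken the leaf of a non-cut vertex, Bob takes that vertex. Otherwise he
takes an unguarded non-cut vertex if there is one. If there is none, some unguarded cut vertex has a
branch of fewer than `k` vertices; the branch contains a non-cut vertex, which must be guarded, and
Bob takes its leaf (`Joined.exists_response`). He thus offers only `outer` vertices, and fewer than
`k` of these exist while `R` has at least `5 * k` vertices (`Joined.ncard_outer_lt`). Alice's gain,
plus the number of exposed vertices, minus twice the number of outer vertices taken, stays at most
`0` after each of Bob's moves (`ncard_exposed_diff_le`). So Alice gains at most about `2 * k` before
`R` shrinks to about `5 * k` vertices, hence at most `9 * k` in all (`secures_bob_corona`).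

The graphs `H` come from a greedy process that adds edges between distant vertices of small degree.
Each edge can be chosen to destroy a constant fraction of the unjoined pairs of `k`-sets; linearly
many edges destroy them all, and a large linked set of vertices of small degree remains
(`exists_sparse_joined`).

Bounded degree bounds the densities of shallow minors. For the local statement the girth tends to
infinity along a sequence, so balls of a fixed radius have minors of density at most `1` in all but
finitely many of the graphs. -/

/-! ### Linked sets of vertices -/

namespace SimpleGraph

variable {V : Type*} {G : SimpleGraph V}

/-- A set of vertices is linked if it has no proper nonempty subset that is closed under adjacency
in it; equivalently, it induces a preconnected subgraph. -/
def Linked (G : SimpleGraph V) (R : Set V) : Prop :=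
  ∀ S ⊆ R, S.Nonempty → (∀ u ∈ S, ∀ v ∈ R, G.Adj u v → v ∈ S) → S = R

/-- The closure form speaks of subsets of `V` only, so that vertices can be removed from `R` without
passing between subtypes. -/
theorem linked_iff_preconnected (G : SimpleGraph V) (R : Set V) :
    G.Linked R ↔ (G.induce R).Preconnected := by
  constructor
  · intro h x y
    have := h {v | ∃ hv : v ∈ R, (G.induce R).Reachable x ⟨v, hv⟩} (fun v hv => hv.1)
      ⟨x, x.2, Reachable.refl _⟩ (fun u hu v hv huv => ⟨hv, hu.2.trans
        (Adj.reachable (G := G.induce R) (u := ⟨u, hu.1⟩) (v := ⟨v, hv⟩) huv)⟩)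
    exact (this.ge y.2).2
  · intro h S hSR ⟨s, hs⟩ hcl
    refine hSR.antisymm fun t ht => ?_
    obtain ⟨w⟩ := h ⟨s, hSR hs⟩ ⟨t, ht⟩
    have key : ∀ (x y : R), (G.induce R).Walk x y → (x : V) ∈ S → (y : V) ∈ S := by
      intro x y w
      induction w with
      | nil => exact id
      | cons hadj _ ih => exact fun hx => ih (hcl _ hx _ (Subtype.property _) hadj)
    exact key _ _ w hs

theorem exists_split_of_not_linked {R : Set V} (h : ¬ G.Linked R) :
    ∃ S ⊆ R, S.Nonempty ∧ (R \ S).Nonempty ∧ ∀ u ∈ S, ∀ v ∈ R, G.Adj u v → v ∈ S := by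
  unfold Linked at h
  push Not at h
  obtain ⟨S, hS, hne, hcl, hSR⟩ := h
  refine ⟨S, hS, hne, ?_, hcl⟩
  by_contra hcon
  rw [Set.not_nonempty_iff_eq_empty, Set.sdiff_eq_empty] at hcon
  exact hSR (hS.antisymm hcon)

/-- As above, with the roles of the parts chosen so that a given vertex is not in the first. -/
theorem exists_split_of_not_linked' {R : Set V} (h : ¬ G.Linked R) (x : V) :
    ∃ S ⊆ R, S.Nonempty ∧ (R \ S).Nonempty ∧ x ∉ S ∧
      ∀ u ∈ S, ∀ v ∈ R, G.Adj u v → v ∈ S := by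
  obtain ⟨S, hS, hne, hne', hcl⟩ := exists_split_of_not_linked h
  by_cases hx : x ∈ S
  · refine ⟨R \ S, Set.sdiff_subset, hne', ?_, fun h => h.2 hx, ?_⟩
    · rwa [Set.sdiff_sdiff_cancel_left hS]
    · intro u hu v hv huv
      exact ⟨hv, fun hvS => hu.2 (hcl v hvS u hu.1 huv.symm)⟩
  · exact ⟨S, hS, hne, hne', hx, hcl⟩

theorem Linked.exists_adj {R : Set V} (h : G.Linked R) {v : V} (hv : v ∈ R)
    (hne : ∃ w ∈ R, w ≠ v) : ∃ w ∈ R, G.Adj v w := by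
  by_contra hcon
  push Not at hcon
  obtain ⟨w, hw, hwv⟩ := hne
  have := h {v} (by simpa using hv) ⟨v, rfl⟩ (by
    rintro u rfl v' hv' hadj
    exact absurd hadj (hcon v' hv'))
  rw [← this] at hw
  exact hwv hw

theorem Linked.insert_of_adj {K : Set V} (h : G.Linked K) {v w : V} (hw : w ∈ K) (hvw : G.Adj v w) :
    G.Linked (insert v K) := by
  intro S hS ⟨s, hs⟩ hcl
  have hK : ∀ t ∈ S, t ∈ K → S = insert v K := by
    intro t ht htK
    have hSK := h (S ∩ K) Set.inter_subset_right ⟨t, ht, htK⟩ (fun a ha b hb hab =>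
      ⟨hcl a ha.1 b (Set.mem_insert_of_mem _ hb) hab, hb⟩)
    have hKS : K ⊆ S := by rw [← hSK]; exact Set.inter_subset_left
    refine hS.antisymm (Set.insert_subset (hcl w (hKS hw) v (Set.mem_insert _ _) hvw.symm) hKS)
  rcases hS hs with rfl | hsK
  · exact hK w (hcl _ hs w (Set.mem_insert_of_mem _ hw) hvw) hw
  · exact hK s hs hsK

/-- If removing the non-cut vertex `v` turns the cut vertex `y` into a non-cut vertex, then `y` is
the only neighbor of `v`. -/
theorem eq_of_adj_of_linked_diff {R : Set V} {v y : V} (hv : v ∈ R) (hvy : v ≠ y)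
    (hy : ¬ G.Linked (R \ {y})) (hy' : G.Linked ((R \ {v}) \ {y})) :
    ∀ w ∈ R, G.Adj v w → w = y := by
  intro w hw hvw
  by_contra hwy
  -- Otherwise `v` can be attached through `w` to the linked set `R \ {v, y}`, and `y` was not a cut
  -- vertex.
  apply hy
  have h := hy'.insert_of_adj (v := v) (w := w) ⟨⟨hw, hvw.ne'⟩, hwy⟩ hvw
  convert h using 1
  ext t
  by_cases ht : t = v
  · subst ht; simp [hv, hvy]
  · simp [ht]

/-- Every branch at a vertex `x` of a linked set contains a vertex whose removal leaves the set
linked. -/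
theorem exists_linked_diff_singleton [Finite V] {R : Set V} (hR : G.Linked R) :
    ∀ {x : V} {S : Set V}, S ⊆ R → x ∉ S → S.Nonempty →
      (∀ u ∈ S, ∀ v ∈ R, G.Adj u v → v ∈ S ∨ v = x) → ∃ u ∈ S, G.Linked (R \ {u}) := by
  suffices ∀ n : ℕ, ∀ {x : V} {S : Set V}, S.ncard = n → S ⊆ R → x ∉ S → S.Nonempty →
      (∀ u ∈ S, ∀ v ∈ R, G.Adj u v → v ∈ S ∨ v = x) → ∃ u ∈ S, G.Linked (R \ {u}) by
    intro x S
    exact this _ rfl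
  intro n
  induction n using Nat.strong_induction_on with
  | _ n ih =>
    intro x S hn hSR hxS ⟨u, hu⟩ hS
    by_contra hcon
    push Not at hcon
    obtain ⟨T, hTR, hT, hT', hxT, hcl⟩ := exists_split_of_not_linked' (hcon u hu) x
    -- If `T` meets `S`, then `T ∩ S` is a smaller branch, at `u`. If not, no vertex of `T` is
    -- adjacent to `u`, so `T` is closed in `R`.
    by_cases hTS : (T ∩ S).Nonempty
    · have huT : u ∉ T := fun h => (hTR h).2 rfl
      obtain ⟨w, hw, hw'⟩ := ih (T ∩ S).ncard (hn ▸ Set.ncard_lt_ncard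
        ⟨Set.inter_subset_right, fun h => huT (h hu).1⟩ (Set.toFinite _)) (x := u) rfl
        (Set.inter_subset_right.trans hSR) (fun h => huT h.1) hTS (by
          intro a ha b hb hab
          by_cases hbu : b = u
          · exact Or.inr hbu
          · have hbT : b ∈ T := hcl a ha.1 b ⟨hb, hbu⟩ hab
            rcases hS a ha.2 b hb hab with h | rfl
            · exact Or.inl ⟨hbT, h⟩
            · exact absurd hbT hxT)
      exact hcon w hw.2 hw'
    · have hdisj : ∀ t ∈ T, t ∉ S := fun t ht hs => hTS ⟨t, ht, hs⟩
      have := hR T (hTR.trans Set.sdiff_subset) hT (by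
        intro a ha b hb hab
        by_cases hbu : b = u
        · subst hbu
          rcases hS b hu a (hTR ha).1 hab.symm with h | rfl
          · exact absurd h (hdisj a ha)
          · exact absurd ha hxT
        · exact hcl a ha b ⟨hb, hbu⟩ hab)
      exact hdisj u (this ▸ hSR hu) hu

theorem Linked.exists_linked_diff [Finite V] {R : Set V} (hR : G.Linked R) (hne : R.Nonempty) :
    ∃ u ∈ R, G.Linked (R \ {u}) := by
  obtain ⟨x, hx⟩ := hne
  by_cases h : (R \ {x}).Nonempty
  · obtain ⟨u, hu, hu'⟩ := exists_linked_diff_singleton hR (x := x) (S := R \ {x})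
      Set.sdiff_subset (fun h => h.2 rfl) h (by
        intro a _ b hb _
        by_cases hbx : b = x
        · exact Or.inr hbx
        · exact Or.inl ⟨hb, hbx⟩)
    exact ⟨u, hu.1, hu'⟩
  · refine ⟨x, hx, ?_⟩
    rw [Set.not_nonempty_iff_eq_empty] at h
    rw [h]
    intro S hS hne
    exact absurd (Set.subset_empty_iff.mp hS) hne.ne_empty

/-! ### Graphs without large empty pairs -/

/-- Any two sets of at least `k` vertices are joined by an edge. -/
def Joined (G : SimpleGraph V) (k : ℕ) : Prop :=
  ∀ A B : Set V, k ≤ A.ncard → k ≤ B.ncard → ∃ a ∈ A, ∃ b ∈ B, G.Adj a b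

/-- The vertices lying in a set of less than `k` vertices with all neighbors in `R`, apart from at
most one vertex, in the set itself. -/
def outer (G : SimpleGraph V) (k : ℕ) (R : Set V) : Set V :=
  {u | ∃ S : Set V, u ∈ S ∧ S.ncard < k ∧ ∃ v, ∀ a ∈ S, ∀ b ∈ R, G.Adj a b → b ∈ S ∨ b = v}

theorem outer_anti {k : ℕ} {R R' : Set V} (h : R' ⊆ R) : G.outer k R ⊆ G.outer k R' := by
  rintro u ⟨S, hu, hS, v, hv⟩
  exact ⟨S, hu, hS, v, fun a ha b hb => hv a ha b (h hb)⟩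

theorem Joined.ncard_outer_lt [Finite V] {k : ℕ} (hk : 0 < k) (hG : G.Joined k) {R : Set V}
    (hR : 5 * k ≤ R.ncard) : (G.outer k R).ncard < k := by
  by_contra hcon
  push Not at hcon
  -- Witness sets are united until `Y` has at least `k` vertices, with `X` collecting their
  -- exceptional vertices. Each witness adds at least one vertex to `Y`, fewer than `k` in all, and
  -- at most one to `X`.
  have key : ∀ n, n ≤ k → ∃ Y X : Set V, n ≤ Y.ncard ∧ Y.ncard < k + k ∧ X.ncard ≤ Y.ncard ∧
      ∀ a ∈ Y, ∀ b ∈ R, G.Adj a b → b ∈ Y ∨ b ∈ X := by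
    intro n
    induction n with
    | zero => exact fun _ => ⟨∅, ∅, by simp, by simp; omega, by simp, by simp⟩
    | succ n ih =>
      intro hn
      obtain ⟨Y, X, h1, h2, h3, h4⟩ := ih (by omega)
      by_cases hY : n + 1 ≤ Y.ncard
      · exact ⟨Y, X, hY, h2, h3, h4⟩
      · obtain ⟨u, hu, huY⟩ := Set.exists_mem_notMem_of_ncard_lt_ncard
          (show Y.ncard < (G.outer k R).ncard by omega)
        obtain ⟨S, huS, hS, v, hv⟩ := hu
        have hlt : Y.ncard < (Y ∪ S).ncard :=
          Set.ncard_lt_ncard ⟨Set.subset_union_left, fun h => huY (h (Or.inr huS))⟩ (Set.toFinite _)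
        have hle := Set.ncard_union_le Y S
        have hX := Set.ncard_insert_le v X
        refine ⟨Y ∪ S, insert v X, by omega, by omega, by omega, ?_⟩
        rintro a (ha | ha) b hb hab
        · rcases h4 a ha b hb hab with h | h
          · exact Or.inl (Or.inl h)
          · exact Or.inr (Or.inr h)
        · rcases hv a ha b hb hab with h | h
          · exact Or.inl (Or.inr h)
          · exact Or.inr (Or.inl h)
  obtain ⟨Y, X, h1, h2, h3, h4⟩ := key k le_rfl
  -- `Y ∪ X` has fewer than `4 * k` vertices, so at least `k` vertices of `R` lie outside it, none
  -- of them adjacent to `Y`.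
  have hdiff : R.ncard ≤ (R \ (Y ∪ X)).ncard + (Y ∪ X).ncard := Set.ncard_le_ncard_sdiff_add_ncard _ _
  have hle := Set.ncard_union_le Y X
  obtain ⟨a, ha, b, hb, hab⟩ := hG Y (R \ (Y ∪ X)) h1 (by omega)
  rcases h4 a ha b hb.1 hab with h | h
  · exact hb.2 (Or.inl h)
  · exact hb.2 (Or.inr h)

/-- A cut vertex of a linked set has a small branch. -/
theorem Joined.exists_branch {k : ℕ} (hG : G.Joined k) {R : Set V} {x : V}
    (hx : ¬ G.Linked (R \ {x})) :
    ∃ S ⊆ R, x ∉ S ∧ S.Nonempty ∧ S.ncard < k ∧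
      ∀ u ∈ S, ∀ v ∈ R, G.Adj u v → v ∈ S ∨ v = x := by
  obtain ⟨S, hS, hne, hne', hcl⟩ := exists_split_of_not_linked hx
  by_cases hSk : S.ncard < k
  · refine ⟨S, hS.trans Set.sdiff_subset, fun h => (hS h).2 rfl, hne, hSk, ?_⟩
    intro u hu v hv huv
    by_cases hvx : v = x
    · exact Or.inr hvx
    · exact Or.inl (hcl u hu v ⟨hv, hvx⟩ huv)
  · refine ⟨(R \ {x}) \ S, Set.sdiff_subset.trans Set.sdiff_subset, fun h => h.1.2 rfl, hne', ?_, ?_⟩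
    · by_contra hcon
      obtain ⟨a, ha, b, hb, hab⟩ := hG S _ (not_lt.mp hSk) (not_lt.mp hcon)
      exact hb.2 (hcl a ha b hb.1 hab)
    · intro u hu v hv huv
      by_cases hvx : v = x
      · exact Or.inr hvx
      · exact Or.inl ⟨⟨hv, hvx⟩, fun h => hu.2 (hcl v h u hu.1 huv.symm)⟩

/-- A set of vertices with no large empty pair in it contains a linked set with nearly all of its
vertices. -/
theorem exists_linked_subset [Finite V] {k : ℕ} (hk : 0 < k) {U : Set V} (hU : 3 * k ≤ U.ncard)
    (hG : ∀ A ⊆ U, ∀ B ⊆ U, k ≤ A.ncard → k ≤ B.ncard → ∃ a ∈ A, ∃ b ∈ B, G.Adj a b) :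
    ∃ C ⊆ U, G.Linked C ∧ U.ncard < C.ncard + k := by
  classical
  -- `C` is a smallest closed part of `U` with at least `k` vertices. It misses fewer than `k`
  -- vertices, so it has more than `2 * k`; if it split, one of its two closed parts would
  -- contradict minimality.
  have hex : ∃ n, ∃ C ⊆ U, C.ncard = n ∧ k ≤ n ∧ ∀ a ∈ C, ∀ b ∈ U, G.Adj a b → b ∈ C :=
    ⟨U.ncard, U, subset_rfl, rfl, by omega, fun _ _ b hb _ => hb⟩
  obtain ⟨C, hCU, hn, hkC, hcl⟩ := Nat.find_spec hex
  have hmin := fun m => Nat.find_min hex (m := m)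
  rw [← hn] at hkC hmin
  have hsub : U.ncard ≤ (U \ C).ncard + C.ncard := Set.ncard_le_ncard_sdiff_add_ncard _ _
  have hbig : (U \ C).ncard < k := by
    by_contra hcon
    obtain ⟨a, ha, b, hb, hab⟩ := hG C hCU (U \ C) Set.sdiff_subset hkC (not_lt.mp hcon)
    exact hb.2 (hcl a ha b hb.1 hab)
  refine ⟨C, hCU, ?_, by omega⟩
  by_contra hlink
  obtain ⟨S, hS, hne, hne', hScl⟩ := exists_split_of_not_linked hlink
  have hcard : C.ncard ≤ (C \ S).ncard + S.ncard := Set.ncard_le_ncard_sdiff_add_ncard _ _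
  have hSlt : S.ncard < C.ncard := Set.ncard_lt_ncard
    ⟨hS, fun h => by obtain ⟨t, ht, ht'⟩ := hne'; exact ht' (h ht)⟩ (Set.toFinite _)
  have hSlt' : (C \ S).ncard < C.ncard := Set.ncard_lt_ncard
    ⟨Set.sdiff_subset, fun h => by obtain ⟨t, ht⟩ := hne; exact (h (hS ht)).2 ht⟩ (Set.toFinite _)
  by_cases hSk : k ≤ S.ncard
  · exact hmin _ hSlt ⟨S, hS.trans hCU, rfl, hSk, fun a ha b hb hab =>
      hScl a ha b (hcl a (hS ha) b hb hab) hab⟩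
  · exact hmin _ hSlt' ⟨C \ S, Set.sdiff_subset.trans hCU, rfl, by omega, fun a ha b hb hab =>
      ⟨hcl a ha.1 b hb hab, fun h => ha.2 (hScl b h a ha.1 hab.symm)⟩⟩

end SimpleGraph

/-! ### Game R: general facts -/

theorem mover_eq_alice {k : ℕ} : mover k = Player.alice ↔ Even k := by
  unfold mover; split_ifs with h <;> simp [h]

theorem mover_eq_bob {k : ℕ} : mover k = Player.bob ↔ ¬ Even k := by
  unfold mover; split_ifs with h <;> simp [h]

namespace WeightedGraph

variable {A : WeightedGraph}

theorem isHistory_nil : A.IsHistory [] := by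
  refine ⟨List.nodup_nil, fun k _ => ?_⟩
  rw [← SimpleGraph.linked_iff_preconnected]
  have h : {v : A.V | v ∉ ([] : List A.V).take k} = Set.univ := by ext; simp
  rw [h, SimpleGraph.linked_iff_preconnected]
  exact (SimpleGraph.Iso.connected_iff (SimpleGraph.induceUnivIso A.graph)).2 A.connected |>.preconnected

theorem isHistory_concat {h : List A.V} {m : A.V} :
    A.IsHistory (h ++ [m]) ↔ A.IsHistory h ∧ m ∉ h ∧ A.graph.Linked {v | v ∉ h ++ [m]} := by
  rw [SimpleGraph.linked_iff_preconnected]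
  constructor
  · rintro ⟨h1, h2⟩
    refine ⟨⟨(List.nodup_append.1 h1).1, fun k hk => ?_⟩, fun hm => ?_, ?_⟩
    · have := h2 k (by simp; omega)
      rwa [List.take_append_of_le_length hk] at this
    · exact (List.nodup_append.1 h1).2.2 m hm m (by simp) rfl
    · have := h2 (h ++ [m]).length le_rfl
      rwa [List.take_length] at this
  · rintro ⟨⟨h1, h2⟩, hm, h3⟩
    refine ⟨List.nodup_append.2 ⟨h1, by simp, ?_⟩, fun k hk => ?_⟩
    · rintro a ha b hb rfl
      rw [List.mem_singleton] at hb
      exact hm (hb ▸ ha)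
    · rcases Nat.lt_or_ge h.length k with hlt | hge
      · rw [List.take_of_length_le (by simp; omega)]
        exact h3
      · rw [List.take_append_of_le_length hge]
        exact h2 k hge

theorem IsHistory.linked {h : List A.V} (hh : A.IsHistory h) : A.graph.Linked {v | v ∉ h} := by
  have := hh.2 h.length le_rfl
  rw [List.take_length] at this
  exact (SimpleGraph.linked_iff_preconnected _ _).2 this

theorem follows_concat {p : Player} {σ : List A.V → A.V} {h : List A.V} {m : A.V} :
    A.Follows p σ (h ++ [m]) ↔ A.Follows p σ h ∧ (mover h.length = p → m = σ h) := by
  constructor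
  · intro hf
    refine ⟨fun k hk => ?_, fun hp => ?_⟩
    · have := hf ⟨k, by simp⟩ hk
      simpa [List.getElem_append_left k.2, List.take_append_of_le_length k.2.le] using this
    · have := hf ⟨h.length, by simp⟩ hp
      simpa using this
  · rintro ⟨hf, hm⟩ ⟨k, hk⟩ hp
    rcases Nat.lt_or_ge k h.length with hlt | hge
    · have := hf ⟨k, hlt⟩ hp
      simpa [List.getElem_append_left hlt, List.take_append_of_le_length hlt.le] using this
    · have hkl : k = h.length := by simp at hk; omega
      subst hkl
      simpa using hm hp

theorem follows_nil {p : Player} {σ : List A.V → A.V} : A.Follows p σ [] :=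
  fun k => absurd k.2 (by simp)

open Classical in
theorem gain_eq_sum_range (p : Player) (h : List A.V) :
    A.gain p h = ∑ k ∈ Finset.range h.length,
      if mover k = p then (h[k]?.map A.weight).getD 0 else 0 := by
  rw [gain, ← Fin.sum_univ_eq_sum_range
    (fun k => if mover k = p then (h[k]?.map A.weight).getD 0 else 0)]
  refine Finset.sum_congr rfl fun k _ => ?_
  simp

theorem gain_nil (p : Player) : A.gain p [] = 0 := by
  simp [gain_eq_sum_range]

open Classical in
theorem gain_concat (p : Player) (h : List A.V) (m : A.V) :
    A.gain p (h ++ [m]) = A.gain p h + if mover h.length = p then A.weight m else 0 := by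
  rw [gain_eq_sum_range, gain_eq_sum_range, List.length_append, List.length_singleton,
    Finset.sum_range_succ]
  congr 1
  · refine Finset.sum_congr rfl fun k hk => ?_
    rw [List.getElem?_append_left (Finset.mem_range.1 hk)]
  · simp

theorem gain_alice_concat_of_not_even {h : List A.V} (he : ¬ Even h.length) (m : A.V) :
    A.gain Player.alice (h ++ [m]) = A.gain Player.alice h := by
  rw [gain_concat, if_neg (fun h => he (mover_eq_alice.1 h)), add_zero]

theorem gain_nonneg (p : Player) (h : List A.V) : 0 ≤ A.gain p h := by
  classical
  unfold gain
  refine Finset.sum_nonneg fun k _ => ?_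
  split_ifs
  · exact A.weight_nonneg _
  · exact le_rfl

theorem get_bijective {h : List A.V} (hn : h.Nodup) (hc : A.IsComplete h) :
    Function.Bijective h.get := by
  refine ⟨List.nodup_iff_injective_get.1 hn, fun v => ?_⟩
  obtain ⟨k, hk⟩ := List.mem_iff_get.1 (hc v)
  exact ⟨k, hk⟩

theorem length_eq_order {h : List A.V} (hn : h.Nodup) (hc : A.IsComplete h) :
    h.length = A.order := by
  have := Fintype.card_of_bijective (get_bijective hn hc)
  simpa [order] using this

theorem gain_add_gain {h : List A.V} (hn : h.Nodup) (hc : A.IsComplete h) :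
    A.gain Player.alice h + A.gain Player.bob h = A.totalWeight := by
  classical
  unfold gain totalWeight
  rw [← (get_bijective hn hc).sum_comp, ← Finset.sum_add_distrib]
  refine Finset.sum_congr rfl fun k _ => ?_
  by_cases hk : Even (k : ℕ)
  · rw [if_pos (mover_eq_alice.2 hk), if_neg (fun h => mover_eq_bob.1 h hk), add_zero]
  · rw [if_neg (fun h => hk (mover_eq_alice.1 h)), if_pos (mover_eq_bob.2 hk), zero_add]

theorem setOf_notMem_concat (h : List A.V) (m : A.V) :
    {v | v ∉ h ++ [m]} = {v | v ∉ h} \ {m} := by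
  ext v; simp

theorem IsHistory.exists_move {h : List A.V} (hh : A.IsHistory h) (hc : ¬ A.IsComplete h) :
    ∃ m, A.IsHistory (h ++ [m]) := by
  unfold IsComplete at hc
  push Not at hc
  obtain ⟨u, hu, hu'⟩ := hh.linked.exists_linked_diff hc
  refine ⟨u, isHistory_concat.2 ⟨hh, hu, ?_⟩⟩
  rwa [setOf_notMem_concat]

/-- Bob secures `x` if there is an invariant which he can restore after each move of Alice and
which, at the end of the game, gives him at least `x`. -/
theorem secures_bob_of_invariant (hA : Even A.order) (J : List A.V → Prop) {x : ℝ} (h0 : J [])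
    (hJ : ∀ h m, Even h.length → J h → A.IsHistory (h ++ [m]) → ¬ A.IsComplete (h ++ [m]) →
      ∃ b, A.IsHistory (h ++ [m] ++ [b]) ∧ J (h ++ [m] ++ [b]))
    (hend : ∀ h, A.IsHistory h → A.IsComplete h → J h → x ≤ A.gain Player.bob h) :
    A.Secures Player.bob x := by
  classical
  have hne : Nonempty A.V := A.connected.nonempty
  have hσ : ∀ h : List A.V, ∃ b, (∃ b, A.IsHistory (h ++ [b]) ∧ J (h ++ [b])) →
      A.IsHistory (h ++ [b]) ∧ J (h ++ [b]) := by
    intro h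
    by_cases hb : ∃ b, A.IsHistory (h ++ [b]) ∧ J (h ++ [b])
    · exact ⟨hb.choose, fun _ => hb.choose_spec⟩
    · exact ⟨hne.some, fun h => absurd h hb⟩
  choose σ hσ using hσ
  -- In an even graph Bob makes the last move, so he can always answer and the invariant holds at
  -- the end.
  have hodd : ∀ h m, A.IsHistory (h ++ [m]) → Even h.length → ¬ A.IsComplete (h ++ [m]) := by
    intro h m hh he hc
    have := length_eq_order hh.1 hc
    rw [← this, List.length_append, List.length_singleton] at hA
    exact (Nat.even_add_one.1 hA) he
  have key : ∀ h : List A.V, A.IsHistory h → A.Follows Player.bob σ h →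
      (Even h.length → J h) ∧ (¬ Even h.length → ∃ h' m, h = h' ++ [m] ∧ Even h'.length ∧ J h') := by
    intro h
    induction h using List.reverseRecOn with
    | nil => exact fun _ _ => ⟨fun _ => h0, fun h => absurd (by simp) h⟩
    | append_singleton h m ih =>
      intro hh hf
      have hh' := (isHistory_concat.1 hh).1
      obtain ⟨hf', hm⟩ := follows_concat.1 hf
      obtain ⟨ih1, ih2⟩ := ih hh' hf'
      rw [List.length_append, List.length_singleton, Nat.even_add_one, not_not]
      refine ⟨fun he => ?_, fun he => ⟨h, m, rfl, he, ih1 he⟩⟩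
      obtain ⟨h', m', rfl, he', hJ'⟩ := ih2 he
      rw [hm (mover_eq_bob.2 he)]
      exact (hσ _ (hJ h' m' he' hJ' hh' (hodd _ _ hh' he'))).2
  refine ⟨σ, fun h hh hf hp hc => ?_, fun h hh hf hc => hend h hh hc ((key h hh hf).1 ?_)⟩
  · obtain ⟨h', m, rfl, he, hJ'⟩ := (key h hh hf).2 (mover_eq_bob.1 hp)
    exact (hσ _ (hJ h' m he hJ' hh hc)).1
  · rwa [length_eq_order hh.1 hc]

/-- The two strategies, played against each other, produce one complete game in which both
guarantees hold. -/
theorem add_le_totalWeight {x y : ℝ} (hx : A.Secures Player.alice x)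
    (hy : A.Secures Player.bob y) : x + y ≤ A.totalWeight := by
  obtain ⟨σ, hσ, hσx⟩ := hx
  obtain ⟨τ, hτ, hτy⟩ := hy
  have key : ∀ n ≤ A.order, ∃ h : List A.V, h.length = n ∧ A.IsHistory h ∧
      A.Follows Player.alice σ h ∧ A.Follows Player.bob τ h := by
    intro n
    induction n with
    | zero => exact fun _ => ⟨[], rfl, isHistory_nil, follows_nil, follows_nil⟩
    | succ n ih =>
      intro hn
      obtain ⟨h, rfl, hh, h1, h2⟩ := ih (by omega)
      have hc : ¬ A.IsComplete h := fun hc => by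
        have := length_eq_order hh.1 hc
        omega
      by_cases he : Even h.length
      · refine ⟨h ++ [σ h], by simp, hσ h hh h1 (mover_eq_alice.2 he) hc,
          follows_concat.2 ⟨h1, fun _ => rfl⟩, follows_concat.2 ⟨h2, fun hb => ?_⟩⟩
        exact absurd he (mover_eq_bob.1 hb)
      · refine ⟨h ++ [τ h], by simp, hτ h hh h2 (mover_eq_bob.2 he) hc,
          follows_concat.2 ⟨h1, fun ha => ?_⟩, follows_concat.2 ⟨h2, fun _ => rfl⟩⟩
        exact absurd (mover_eq_alice.1 ha) he
  obtain ⟨h, hl, hh, h1, h2⟩ := key A.order le_rfl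
  have hc : A.IsComplete h := by
    classical
    intro v
    have : h.toFinset = Finset.univ :=
      Finset.eq_univ_of_card _ (by rw [List.toFinset_card_of_nodup hh.1, hl, order])
    rw [← List.mem_toFinset, this]
    exact Finset.mem_univ v
  rw [← gain_add_gain hh.1 hc]
  exact add_le_add (hσx h hh h1 hc) (hτy h hh h2 hc)

/-- A legal move always exists, so the supremum defining `aliceGain` is over a nonempty set. -/
theorem secures_alice_zero : A.Secures Player.alice 0 := by
  classical
  have hne : Nonempty A.V := A.connected.nonempty
  have hσ : ∀ h : List A.V, ∃ b, A.IsHistory h → ¬ A.IsComplete h → A.IsHistory (h ++ [b]) := by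
    intro h
    by_cases hb : A.IsHistory h ∧ ¬ A.IsComplete h
    · exact ⟨_, fun _ _ => (hb.1.exists_move hb.2).choose_spec⟩
    · exact ⟨hne.some, fun h1 h2 => absurd ⟨h1, h2⟩ hb⟩
  choose σ hσ using hσ
  exact ⟨σ, fun h hh _ _ hc => hσ h hh hc, fun h _ _ _ => gain_nonneg _ _⟩

theorem aliceGain_le {y : ℝ} (hy : A.Secures Player.bob y) : A.aliceGain ≤ A.totalWeight - y :=
  csSup_le ⟨0, secures_alice_zero⟩ fun _ hx => le_sub_iff_add_le.2 (add_le_totalWeight hx hy)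

theorem aliceGain_nonneg {y : ℝ} (hy : A.Secures Player.bob y) : 0 ≤ A.aliceGain :=
  le_csSup ⟨A.totalWeight - y, fun _ hx => le_sub_iff_add_le.2 (add_le_totalWeight hx hy)⟩
    secures_alice_zero

end WeightedGraph

/-! ### Coronas -/

namespace SimpleGraph

variable {V : Type} {H : SimpleGraph V}

/-- The graph obtained from `H` by attaching a leaf `(v, true)` to each vertex `v = (v, false)`. -/
def corona (H : SimpleGraph V) : SimpleGraph (V × Bool) where
  Adj x y := (x.2 = false ∧ y.2 = false ∧ H.Adj x.1 y.1) ∨ (x.1 = y.1 ∧ x.2 ≠ y.2)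
  symm := ⟨fun _ _ h => h.elim (fun h => Or.inl ⟨h.2.1, h.1, h.2.2.symm⟩)
    fun h => Or.inr ⟨h.1.symm, h.2.symm⟩⟩
  loopless := ⟨fun _ h => h.elim (fun h => h.2.2.ne rfl) fun h => h.2 rfl⟩

theorem corona_adj_false {u v : V} : H.corona.Adj (u, false) (v, false) ↔ H.Adj u v := by
  simp [corona]

theorem corona_adj_true {u : V} {y : V × Bool} :
    H.corona.Adj (u, true) y ↔ y = (u, false) := by
  obtain ⟨v, b⟩ := y
  cases b <;> simp [corona, @eq_comm _ u]

theorem linked_corona {X : Set (V × Bool)} (hL : ∀ v, (v, true) ∈ X → (v, false) ∈ X)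
    (hR : H.Linked {v | (v, false) ∈ X}) : H.corona.Linked X := by
  intro S hS hne hcl
  have hcore : ∀ v, (v, true) ∈ S → (v, false) ∈ S := fun v hv =>
    hcl _ hv _ (hL v (hS hv)) (corona_adj_true.2 rfl)
  have h := hR {v | (v, false) ∈ S} (fun v hv => hS hv) (by
    obtain ⟨⟨v, b⟩, hv⟩ := hne
    cases b
    · exact ⟨v, hv⟩
    · exact ⟨v, hcore v hv⟩) fun u hu v hv huv => hcl _ hu _ hv (corona_adj_false.2 huv)
  refine hS.antisymm ?_
  rintro ⟨v, b⟩ hv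
  cases b
  · exact h.ge hv
  · exact hcl _ (h.ge (hL v hv)) _ hv (corona_adj_true.2 rfl).symm

/-- A leaf without its core vertex would be isolated from the rest of `X`. This is how leaves guard
the core. -/
theorem Linked.of_corona {X : Set (V × Bool)} (hX : H.corona.Linked X)
    (hne : ∃ v, (v, false) ∈ X) :
    (∀ v, (v, true) ∈ X → (v, false) ∈ X) ∧ H.Linked {v | (v, false) ∈ X} := by
  obtain ⟨w, hw⟩ := hne
  constructor
  · intro v hv
    by_contra hcon
    have := hX {(v, true)} (by simpa using hv) ⟨_, rfl⟩ (by
      rintro _ rfl y hy hadj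
      rw [corona_adj_true] at hadj
      exact absurd (hadj ▸ hy) hcon)
    rw [← this] at hw
    simp at hw
  · intro S hS ⟨s, hs⟩ hcl
    have := hX {x | x ∈ X ∧ x.1 ∈ S} (fun x hx => hx.1) ⟨(s, false), hS hs, hs⟩ (by
      rintro x hx y hy hadj
      refine ⟨hy, ?_⟩
      rcases hadj with ⟨_, hy2, hadj⟩ | ⟨h, _⟩
      · refine hcl _ hx.2 _ ?_ hadj
        obtain ⟨y1, y2⟩ := y
        cases hy2
        exact hy
      · exact h ▸ hx.2)
    refine hS.antisymm fun v hv => ?_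
    exact (this.ge hv).2

theorem corona_connected (hH : H.Connected) :
    H.corona.Connected := by
  have := hH.nonempty
  have huniv : ∀ {W : Type} (G : SimpleGraph W), G.Linked Set.univ ↔ G.Preconnected := by
    intro W G
    rw [linked_iff_preconnected]
    exact (SimpleGraph.induceUnivIso G).preconnected_iff
  have h : H.corona.Linked Set.univ := linked_corona (fun _ _ => Set.mem_univ _) (by
    simpa using (huniv H).2 hH.preconnected)
  exact ⟨(huniv _).1 h⟩

/-- The unguarded non-cut vertices that are not outer, for a set `R` of remaining vertices of the
core and a set `L` of guarded ones. -/
def exposed (H : SimpleGraph V) (k : ℕ) (R L : Set V) : Set V :=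
  {y | y ∈ R ∧ y ∉ L ∧ H.Linked (R \ {y}) ∧ y ∉ H.outer k R}

/-- Taking `v` lowers the potential, exposed vertices minus twice the taken outer ones, by at least
`1`. A newly exposed vertex must be the only neighbor of `v`. If `v` is outer, at most one vertex is
gained against a drop of `2`. If `v` is not outer, nothing is gained, since a vertex with one
neighbor is outer through its singleton (here `1 < k`), and `v` itself ceases to be exposed. -/
theorem ncard_exposed_diff_le [Finite V] {k : ℕ} (hk : 1 < k) {R L : Set V} {v : V} (hv : v ∈ R)
    (hvL : v ∉ L) (hR : H.Linked R) (hRv : H.Linked (R \ {v})) (hne : ∃ w ∈ R, w ≠ v) :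
    (H.exposed k (R \ {v}) L).ncard + 1 + 2 * (H.outer k R \ R).ncard ≤
      (H.exposed k R L).ncard + 2 * (H.outer k (R \ {v}) \ (R \ {v})).ncard := by
  have hanti : H.outer k R ⊆ H.outer k (R \ {v}) := outer_anti Set.sdiff_subset
  have hsub : H.outer k R \ R ⊆ H.outer k (R \ {v}) \ (R \ {v}) :=
    fun u hu => ⟨hanti hu.1, fun h => hu.2 h.1⟩
  have hnew : ∀ y ∈ H.exposed k (R \ {v}) L, y ∉ H.exposed k R L →
      ∀ w ∈ R, H.Adj v w → w = y := by
    rintro y ⟨hy1, hy2, hy3, hy4⟩ hy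
    exact eq_of_adj_of_linked_diff hv (Ne.symm hy1.2)
      (fun h => hy ⟨hy1.1, hy2, h, fun h => hy4 (hanti h)⟩) hy3
  by_cases hvO : v ∈ H.outer k R
  · obtain ⟨w, hw, hvw⟩ := hR.exists_adj hv hne
    have h1 : H.exposed k (R \ {v}) L ⊆ insert w (H.exposed k R L) := by
      intro y hy
      by_cases hy' : y ∈ H.exposed k R L
      · exact Or.inr hy'
      · exact Or.inl (hnew y hy hy' w hw hvw).symm
    have h2 := (Set.ncard_le_ncard h1 (Set.toFinite _)).trans (Set.ncard_insert_le _ _)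
    have h3 : (H.outer k R \ R).ncard < (H.outer k (R \ {v}) \ (R \ {v})).ncard :=
      Set.ncard_lt_ncard ⟨hsub, fun h => (h ⟨hanti hvO, fun h => h.2 rfl⟩).2 hv⟩ (Set.toFinite _)
    omega
  · have h1 : H.exposed k (R \ {v}) L ⊂ H.exposed k R L := by
      refine ⟨fun y hy => ?_, fun h => (h ⟨hv, hvL, hRv, hvO⟩).1.2 rfl⟩
      by_contra hy'
      refine hvO ⟨{v}, rfl, by simpa using hk, y, ?_⟩
      rintro a rfl b hb hab
      exact Or.inr (hnew y hy hy' b hb hab)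
    have h2 := Set.ncard_lt_ncard h1 (Set.toFinite _)
    have h3 := Set.ncard_le_ncard hsub (Set.toFinite _)
    omega

theorem exposed_diff_subset {k : ℕ} {R L : Set V} {v : V} :
    H.exposed k R (L \ {v}) ⊆ insert v (H.exposed k R L) := by
  rintro y ⟨h1, h2, h3, h4⟩
  by_cases hy : y = v
  · exact Or.inl hy
  · exact Or.inr ⟨h1, fun h => h2 ⟨h, hy⟩, h3, h4⟩

/-- Hence it is harmless when Alice takes the leaf of a cut vertex, or Bob the leaf of an outer
vertex. -/
theorem exposed_diff_subset' {k : ℕ} {R L : Set V} {v : V}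
    (hv : ¬ H.Linked (R \ {v}) ∨ v ∈ H.outer k R) :
    H.exposed k R (L \ {v}) ⊆ H.exposed k R L := by
  rintro y hy
  rcases exposed_diff_subset hy with rfl | h
  · rcases hv with h | h
    · exact absurd hy.2.2.1 h
    · exact absurd h hy.2.2.2
  · exact h

/-- If an odd number of vertices are unguarded, then one of them is not a cut vertex, or a guarded
vertex is outer. -/
theorem Joined.exists_response [Finite V] {k : ℕ} (hH : H.Joined k) {R L : Set V}
    (hR : H.Linked R) (hodd : ¬ Even (R \ L).ncard) :
    (∃ y ∈ R, y ∉ L ∧ H.Linked (R \ {y})) ∨ ∃ u ∈ L, u ∈ H.outer k R := by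
  by_contra hcon
  push Not at hcon
  obtain ⟨h1, h2⟩ := hcon
  have hne : (R \ L).Nonempty := by
    rw [Set.nonempty_iff_ne_empty]
    intro h
    simp [h] at hodd
  obtain ⟨x, hx, hxL⟩ := hne
  -- The small branch at `x` is itself the set showing that its vertices are outer.
  obtain ⟨S, hSR, hxS, hS, hSk, hcl⟩ := hH.exists_branch (h1 x hx hxL)
  obtain ⟨u, hu, hu'⟩ := exists_linked_diff_singleton hR hSR hxS hS hcl
  by_cases huL : u ∈ L
  · exact h2 u huL ⟨S, hu, hSk, x, hcl⟩
  · exact h1 u (hSR hu) huL hu'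

end SimpleGraph

/-! ### Bob's strategy on a corona -/

namespace WeightedGraph

section

variable {V : Type}

/-- The vertices of the core that have not been taken. -/
def coreLeft (h : List (V × Bool)) : Set V := {v | (v, false) ∉ h}

/-- The vertices of the core whose leaves have not been taken. -/
def guarded (h : List (V × Bool)) : Set V := {v | (v, true) ∉ h}

theorem coreLeft_concat_false (h : List (V × Bool)) (v : V) :
    coreLeft (h ++ [(v, false)]) = coreLeft h \ {v} := by
  ext; simp [coreLeft]

theorem coreLeft_concat_true (h : List (V × Bool)) (v : V) :
    coreLeft (h ++ [(v, true)]) = coreLeft h := by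
  ext; simp [coreLeft]

theorem guarded_concat_false (h : List (V × Bool)) (v : V) :
    guarded (h ++ [(v, false)]) = guarded h := by
  ext; simp [guarded]

theorem guarded_concat_true (h : List (V × Bool)) (v : V) :
    guarded (h ++ [(v, true)]) = guarded h \ {v} := by
  ext; simp [guarded]

end

variable {V : Type} [Fintype V] {H : SimpleGraph V} {hH : H.Connected}

/-- The corona of `H`, with weight `1` on the vertices of `H` and weight `0` on the leaves. -/
def corona (H : SimpleGraph V) (hH : H.Connected) : WeightedGraph where
  V := V × Bool
  graph := H.corona
  connected := SimpleGraph.corona_connected hH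
  weight x := if x.2 then 0 else 1
  weight_nonneg x := by split_ifs <;> simp

theorem corona_isZeroOne : (corona H hH).IsZeroOne := by
  rintro ⟨v, b⟩
  cases b <;> simp [corona]

theorem corona_order : (corona H hH).order = Fintype.card V * 2 :=
  Fintype.card_prod V Bool

theorem corona_totalWeight : (corona H hH).totalWeight = Fintype.card V := by
  have h : (corona H hH).totalWeight = ∑ x : V × Bool, if x.2 then (0 : ℝ) else 1 := rfl
  simp [h, Fintype.sum_prod_type]

/-- Alice's gain on the corona of `H`. -/
noncomputable def coronaGain (H : SimpleGraph V) (hH : H.Connected) (h : List (V × Bool)) : ℝ :=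
  (corona H hH).gain Player.alice h

theorem coronaGain_concat_true (h : List (V × Bool)) (v : V) :
    coronaGain H hH (h ++ [(v, true)]) = coronaGain H hH h := by
  have h1 := gain_concat (A := corona H hH) Player.alice h (v, true)
  have h3 : (corona H hH).weight (v, true) = 0 := by simp [corona]
  rw [h3, ite_self, add_zero] at h1
  exact h1

theorem coronaGain_concat_false_le (h : List (V × Bool)) (v : V) :
    coronaGain H hH (h ++ [(v, false)]) ≤ coronaGain H hH h + 1 := by
  classical
  have h1 := gain_concat (A := corona H hH) Player.alice h (v, false)
  have h3 : (corona H hH).weight (v, false) = 1 := by simp [corona]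
  rw [h3] at h1
  refine h1.trans_le (add_le_add le_rfl ?_)
  split_ifs <;> simp

theorem coronaGain_concat_false {h : List (V × Bool)} (he : ¬ Even h.length) (v : V) :
    coronaGain H hH (h ++ [(v, false)]) = coronaGain H hH h :=
  gain_alice_concat_of_not_even (A := corona H hH) (h := h) he (v, false)

/-- A position in which Alice has gained little compared with the number of outer vertices that
have been taken. -/
def Favorable (H : SimpleGraph V) (hH : H.Connected) (k : ℕ) (h : List (V × Bool)) : Prop :=
  guarded h ⊆ coreLeft h ∧
    coronaGain H hH h + (H.exposed k (coreLeft h) (guarded h)).ncard ≤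
      2 * (H.outer k (coreLeft h) \ coreLeft h).ncard

/-- The invariant that Bob maintains when it is Alice's turn. -/
def BobInvariant (H : SimpleGraph V) (hH : H.Connected) (k : ℕ) (h : List (V × Bool)) : Prop :=
  (5 * k + 2 ≤ (coreLeft h).ncard ∧ Even (coreLeft h \ guarded h).ncard ∧ Favorable H hH k h) ∨
    coronaGain H hH h + (coreLeft h).ncard ≤ 9 * k

theorem linked_of_isHistory {h : List (V × Bool)} (hh : (corona H hH).IsHistory h)
    (hne : (coreLeft h).Nonempty) : guarded h ⊆ coreLeft h ∧ H.Linked (coreLeft h) :=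
  SimpleGraph.Linked.of_corona (IsHistory.linked hh) hne

theorem isHistory_concat_false {h : List (V × Bool)} (hh : (corona H hH).IsHistory h) {v : V}
    (hv : v ∈ coreLeft h) (hL : guarded h ⊆ coreLeft h \ {v}) (hR : H.Linked (coreLeft h \ {v})) :
    (corona H hH).IsHistory (h ++ [(v, false)]) := by
  refine isHistory_concat.2 ⟨hh, hv, SimpleGraph.linked_corona (fun w hw => ?_) ?_⟩
  · rw [← guarded_concat_false h v, ← coreLeft_concat_false] at hL
    exact hL hw
  · rw [← coreLeft_concat_false] at hR
    exact hR

theorem isHistory_concat_true {h : List (V × Bool)} (hh : (corona H hH).IsHistory h) {v : V}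
    (hv : v ∈ guarded h) (hL : guarded h ⊆ coreLeft h) (hR : H.Linked (coreLeft h)) :
    (corona H hH).IsHistory (h ++ [(v, true)]) := by
  refine isHistory_concat.2 ⟨hh, hv, SimpleGraph.linked_corona (fun w hw => ?_) ?_⟩
  · have : w ∈ guarded (h ++ [(v, true)]) := hw
    rw [guarded_concat_true] at this
    have : w ∈ coreLeft (h ++ [(v, true)]) := by
      rw [coreLeft_concat_true]
      exact hL this.1
    exact this
  · rw [← coreLeft_concat_true h v] at hR
    exact hR

/-- Alice gains only by removing a core vertex. So the second alternative of `BobInvariant` survives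
any play. -/
theorem gain_add_ncard_concat_le {h : List (V × Bool)} {m : V × Bool} (hm : m ∉ h) :
    coronaGain H hH (h ++ [m]) + (coreLeft (h ++ [m])).ncard ≤
      coronaGain H hH h + (coreLeft h).ncard := by
  obtain ⟨v, b⟩ := m
  cases b
  · have h2 := Set.ncard_sdiff_singleton_add_one (s := coreLeft h) (a := v) hm
    have h1 := coronaGain_concat_false_le (H := H) (hH := hH) h v
    rw [coreLeft_concat_false, ← h2]
    push_cast
    linarith
  · rw [coreLeft_concat_true, coronaGain_concat_true]

/-- A taken leaf creates an unguarded vertex, and a taken core vertex was an unguarded one. -/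
theorem even_ncard_diff_concat {h : List (V × Bool)} {m : V × Bool} (hm : m ∉ h)
    (hL : guarded h ⊆ coreLeft h) (hL' : guarded (h ++ [m]) ⊆ coreLeft (h ++ [m])) :
    Even (coreLeft (h ++ [m]) \ guarded (h ++ [m])).ncard ↔
      ¬ Even (coreLeft h \ guarded h).ncard := by
  obtain ⟨v, b⟩ := m
  cases b
  · rw [coreLeft_concat_false, guarded_concat_false] at *
    have hv : v ∈ coreLeft h \ guarded h := ⟨hm, fun h => (hL' h).2 rfl⟩
    rw [Set.sdiff_sdiff_comm, ← Set.ncard_sdiff_singleton_add_one hv, Nat.even_add_one, not_not]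
  · rw [coreLeft_concat_true, guarded_concat_true]
    have hv : v ∈ guarded h := hm
    have : coreLeft h \ (guarded h \ {v}) = insert v (coreLeft h \ guarded h) := by
      ext w
      by_cases hw : w = v
      · subst hw; simp [hL hv]
      · simp [hw]
    rw [this, Set.ncard_insert_of_notMem (fun h => h.2 hv), Nat.even_add_one]

variable {k : ℕ}

/-- A round removes at most two core vertices, so when their number falls below `5 * k + 2` it is
still at least `5 * k` and the bound on outer vertices applies. Alice then has at most `2 * k`, and
even all the remaining core leaves her within `9 * k`. -/
theorem BobInvariant.of_favorable (hk : 1 < k) (hJ : H.Joined k) {h : List (V × Bool)}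
    (hR : 5 * k ≤ (coreLeft h).ncard) (he : Even (coreLeft h \ guarded h).ncard)
    (hF : Favorable H hH k h) : BobInvariant H hH k h := by
  by_cases hR' : 5 * k + 2 ≤ (coreLeft h).ncard
  · exact Or.inl ⟨hR', he, hF⟩
  · right
    have h1 := hJ.ncard_outer_lt (by omega) hR
    have h2 : (H.outer k (coreLeft h) \ coreLeft h).ncard ≤ (H.outer k (coreLeft h)).ncard :=
      Set.ncard_le_ncard Set.sdiff_subset (Set.toFinite _)
    have h3 : ((H.outer k (coreLeft h) \ coreLeft h).ncard : ℝ) ≤ k := by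
      exact_mod_cast (by omega)
    have h4 : ((coreLeft h).ncard : ℝ) ≤ 5 * k + 2 := by exact_mod_cast (by omega)
    have h5 : (2 : ℝ) ≤ k := by exact_mod_cast hk
    have h6 := hF.2
    have h7 : (0 : ℝ) ≤ (H.exposed k (coreLeft h) (guarded h)).ncard := Nat.cast_nonneg _
    linarith

theorem favorable_concat_false (hk : 1 < k) {h : List (V × Bool)} {v : V}
    (hF : Favorable H hH k h) (hv : v ∈ coreLeft h) (hvL : v ∉ guarded h)
    (hR : H.Linked (coreLeft h)) (hRv : H.Linked (coreLeft h \ {v}))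
    (hne : ∃ w ∈ coreLeft h, w ≠ v) : Favorable H hH k (h ++ [(v, false)]) := by
  unfold Favorable
  have h1 := SimpleGraph.ncard_exposed_diff_le (k := k) hk hv hvL hR hRv hne
  have h2 := coronaGain_concat_false_le (H := H) (hH := hH) h v
  rw [coreLeft_concat_false, guarded_concat_false]
  refine ⟨fun w hw => ⟨hF.1 hw, fun h => hvL (h ▸ hw)⟩, ?_⟩
  have h4 := hF.2
  have h5 : ((H.exposed k (coreLeft h \ {v}) (guarded h)).ncard : ℝ) + 1 +
    2 * (H.outer k (coreLeft h) \ coreLeft h).ncard ≤ (H.exposed k (coreLeft h) (guarded h)).ncard +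
      2 * (H.outer k (coreLeft h \ {v}) \ (coreLeft h \ {v})).ncard := by exact_mod_cast h1
  linarith

theorem favorable_concat_true {h : List (V × Bool)} {v : V} (hF : Favorable H hH k h)
    (hv : ¬ H.Linked (coreLeft h \ {v}) ∨ v ∈ H.outer k (coreLeft h)) :
    Favorable H hH k (h ++ [(v, true)]) := by
  unfold Favorable
  rw [coreLeft_concat_true, guarded_concat_true, coronaGain_concat_true]
  refine ⟨Set.sdiff_subset.trans hF.1, ?_⟩
  have h4 := hF.2
  have h5 : ((H.exposed k (coreLeft h) (guarded h \ {v})).ncard : ℝ) ≤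
      (H.exposed k (coreLeft h) (guarded h)).ncard := by
    exact_mod_cast Set.ncard_le_ncard (SimpleGraph.exposed_diff_subset' hv) (Set.toFinite _)
  linarith

/-- Bob's answer to Alice's taking the leaf of a vertex that is not a cut vertex. -/
theorem favorable_concat_concat (hk : 1 < k) {h : List (V × Bool)} {v : V}
    (hF : Favorable H hH k h) (hv : v ∈ coreLeft h) (he : Even h.length)
    (hR : H.Linked (coreLeft h)) (hRv : H.Linked (coreLeft h \ {v}))
    (hne : ∃ w ∈ coreLeft h, w ≠ v) : Favorable H hH k (h ++ [(v, true)] ++ [(v, false)]) := by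
  unfold Favorable
  have h1 := SimpleGraph.ncard_exposed_diff_le (k := k) hk hv (fun h => h.2 rfl) hR hRv hne
    (L := guarded h \ {v})
  rw [coreLeft_concat_false, guarded_concat_false, coreLeft_concat_true, guarded_concat_true,
    coronaGain_concat_false (by simpa [Nat.even_add_one] using he), coronaGain_concat_true]
  refine ⟨fun w hw => ⟨hF.1 hw.1, hw.2⟩, ?_⟩
  have h4 := hF.2
  -- Alice's move exposes at most `v`; Bob's taking `v` lowers the potential by `1` without adding
  -- to her gain.
  have h5 : (H.exposed k (coreLeft h) (guarded h \ {v})).ncard ≤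
      (H.exposed k (coreLeft h) (guarded h)).ncard + 1 :=
    (Set.ncard_le_ncard SimpleGraph.exposed_diff_subset (Set.toFinite _)).trans
      (Set.ncard_insert_le _ _)
  have h6 : ((H.exposed k (coreLeft h \ {v}) (guarded h \ {v})).ncard : ℝ) + 1 +
    2 * (H.outer k (coreLeft h) \ coreLeft h).ncard ≤
      (H.exposed k (coreLeft h) (guarded h)).ncard + 1 +
      2 * (H.outer k (coreLeft h \ {v}) \ (coreLeft h \ {v})).ncard := by
    exact_mod_cast (by omega)
  linarith

/-- Bob's answer in all other cases. -/
theorem exists_answer (hk : 1 < k) (hJ : H.Joined k) {h : List (V × Bool)}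
    (hh : (corona H hH).IsHistory h) (hcard : 5 * k + 1 ≤ (coreLeft h).ncard)
    (hodd : ¬ Even (coreLeft h \ guarded h).ncard) (hF : Favorable H hH k h) :
    ∃ b, (corona H hH).IsHistory (h ++ [b]) ∧ BobInvariant H hH k (h ++ [b]) := by
  have hne : (coreLeft h).Nonempty := by
    rw [Set.nonempty_iff_ne_empty]
    intro h
    simp [h] at hcard
  obtain ⟨hL, hR⟩ := linked_of_isHistory hh hne
  rcases hJ.exists_response (L := guarded h) hR hodd with ⟨y, hy, hyL, hRy⟩ | ⟨u, huL, hu⟩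
  · have hmem : (y, false) ∉ h := hy
    have hcard' := Set.ncard_sdiff_singleton_add_one hy
    have hF' := favorable_concat_false hk hF hy hyL hR hRy
      (Set.exists_ne_of_one_lt_ncard (by omega) y)
    refine ⟨(y, false), isHistory_concat_false hh hy
      (fun w hw => ⟨hL hw, fun h => hyL (h ▸ hw)⟩) hRy, .of_favorable hk hJ ?_ ?_ hF'⟩
    · rw [coreLeft_concat_false]
      omega
    · exact (even_ncard_diff_concat hmem hL hF'.1).2 hodd
  · have hmem : (u, true) ∉ h := huL
    have hF' := favorable_concat_true hF (Or.inr hu)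
    refine ⟨(u, true), isHistory_concat_true hh huL hL hR, .of_favorable hk hJ ?_ ?_ hF'⟩
    · rw [coreLeft_concat_true]
      omega
    · exact (even_ncard_diff_concat hmem hL hF'.1).2 hodd

theorem BobInvariant.exists_answer (hk : 1 < k) (hJ : H.Joined k) {h : List (V × Bool)}
    {m : V × Bool} (he : Even h.length) (hI : BobInvariant H hH k h)
    (hh : (corona H hH).IsHistory (h ++ [m])) (hc : ¬ (corona H hH).IsComplete (h ++ [m])) :
    ∃ b, (corona H hH).IsHistory (h ++ [m] ++ [b]) ∧ BobInvariant H hH k (h ++ [m] ++ [b]) := by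
  obtain ⟨hh', hm, -⟩ := isHistory_concat.1 hh
  rcases hI with ⟨hcard, heven, hF⟩ | hI
  · have hne : (coreLeft h).Nonempty := by
      rw [Set.nonempty_iff_ne_empty]
      intro h
      simp [h] at hcard
    have hR := (linked_of_isHistory hh' hne).2
    have hother := Set.exists_ne_of_one_lt_ncard (show 1 < (coreLeft h).ncard by omega) m.1
    obtain ⟨v, b⟩ := m
    cases b
    · have hv : v ∈ coreLeft h := hm
      obtain ⟨w, hw, hwv⟩ := hother
      obtain ⟨hL', hR'⟩ := linked_of_isHistory hh (by
        rw [coreLeft_concat_false]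
        exact ⟨w, hw, hwv⟩)
      have hcard' := Set.ncard_sdiff_singleton_add_one hv
      refine WeightedGraph.exists_answer hk hJ hh ?_ ?_ ?_
      · rw [coreLeft_concat_false]
        omega
      · rw [even_ncard_diff_concat hm hF.1 hL', not_not]
        exact heven
      · rw [coreLeft_concat_false] at hR'
        rw [coreLeft_concat_false, guarded_concat_false] at hL'
        exact favorable_concat_false hk hF hv (fun h => (hL' h).2 rfl) hR hR' ⟨w, hw, hwv⟩
    · have hv : v ∈ coreLeft h := hF.1 hm
      have hL' : guarded (h ++ [(v, true)]) ⊆ coreLeft (h ++ [(v, true)]) := by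
        rw [coreLeft_concat_true, guarded_concat_true]
        exact Set.sdiff_subset.trans hF.1
      have hodd : ¬ Even (coreLeft (h ++ [(v, true)]) \ guarded (h ++ [(v, true)])).ncard := by
        rw [even_ncard_diff_concat hm hF.1 hL', not_not]
        exact heven
      by_cases hRv : H.Linked (coreLeft h \ {v})
      · have hF' := favorable_concat_concat hk hF hv he hR hRv hother
        have hcard' := Set.ncard_sdiff_singleton_add_one hv
        have hv' : v ∈ coreLeft (h ++ [(v, true)]) := by rwa [coreLeft_concat_true]
        refine ⟨(v, false), isHistory_concat_false hh hv' ?_ ?_, .of_favorable hk hJ ?_ ?_ hF'⟩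
        · rw [coreLeft_concat_true, guarded_concat_true]
          exact fun w hw => ⟨hF.1 hw.1, hw.2⟩
        · rwa [coreLeft_concat_true]
        · rw [coreLeft_concat_false, coreLeft_concat_true]
          omega
        · exact (even_ncard_diff_concat hv' hL' hF'.1).2 hodd
      · refine WeightedGraph.exists_answer hk hJ hh ?_ hodd (favorable_concat_true hF (Or.inl hRv))
        rw [coreLeft_concat_true]
        omega
  -- In the endgame any legal move will do.
  · obtain ⟨b, hb⟩ := hh.exists_move hc
    exact ⟨b, hb, Or.inr ((gain_add_ncard_concat_le (isHistory_concat.1 hb).2.1).trans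
      ((gain_add_ncard_concat_le hm).trans hI))⟩

theorem bobInvariant_nil (hk : 1 < k) : BobInvariant H hH k [] := by
  have h1 : coreLeft ([] : List (V × Bool)) = Set.univ := by ext; simp [coreLeft]
  have h2 : guarded ([] : List (V × Bool)) = Set.univ := by ext; simp [guarded]
  have h3 : H.exposed k Set.univ Set.univ = ∅ := by ext; simp [SimpleGraph.exposed]
  have h4 : coronaGain H hH [] = 0 := gain_nil _
  by_cases hcard : 5 * k + 2 ≤ (Set.univ : Set V).ncard
  · left
    refine ⟨by rwa [h1], by simp [h1, h2], ?_⟩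
    unfold Favorable
    rw [h1, h2, h3, h4]
    exact ⟨subset_rfl, by simp⟩
  · right
    rw [h1, h4, zero_add]
    exact_mod_cast (by omega)

theorem BobInvariant.coronaGain_le {h : List (V × Bool)} (hc : ∀ v, v ∈ h)
    (hI : BobInvariant H hH k h) : coronaGain H hH h ≤ 9 * k := by
  have h1 : coreLeft h = ∅ := by
    ext v
    simpa [coreLeft] using hc (v, false)
  rcases hI with ⟨hcard, -, -⟩ | hI
  · simp [h1] at hcard
  · rwa [h1, Set.ncard_empty, Nat.cast_zero, add_zero] at hI

/-- On the corona of a graph in which any two sets of `k` vertices are joined by an edge, Bob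
secures all but at most `9 * k` of the total weight. -/
theorem secures_bob_corona (hk : 1 < k) (hJ : H.Joined k) :
    (corona H hH).Secures Player.bob ((corona H hH).totalWeight - 9 * k) := by
  refine secures_bob_of_invariant ⟨Fintype.card V, by rw [corona_order]; ring⟩
    (BobInvariant H hH k) (bobInvariant_nil hk)
    ?_ ?_
  · exact fun h m he hI hh hc => BobInvariant.exists_answer hk hJ he hI hh hc
  · intro h hh hc hI
    have h1 : (corona H hH).gain Player.alice h ≤ 9 * k := BobInvariant.coronaGain_le hc hI
    linarith [gain_add_gain hh.1 hc]

end WeightedGraph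

/-! ### Sparse graphs of large girth without large empty pairs -/

namespace SimpleGraph

section

variable {V : Type*} {G : SimpleGraph V}

/-- All cycles have length at least `g`. -/
def NoShortCycle (G : SimpleGraph V) (g : ℕ) : Prop :=
  ∀ (v : V) (c : G.Walk v v), c.IsCycle → g ≤ c.length

theorem noShortCycle_bot (g : ℕ) : (⊥ : SimpleGraph V).NoShortCycle g :=
  fun _ _ hc => absurd hc (isAcyclic_bot _)

/-- Adding an edge between two distant vertices creates no short cycle. -/
theorem NoShortCycle.sup_edge {g : ℕ} (hG : G.NoShortCycle g) {u v : V}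
    (hfar : ∀ p : G.Walk u v, g < p.length) : (G ⊔ edge u v).NoShortCycle g := by
  classical
  have hadj : ∀ e, e ∈ (G ⊔ edge u v).edgeSet → e ≠ s(u, v) → e ∈ G.edgeSet := by
    intro e
    induction e with
    | _ a b =>
      intro he hne
      rcases he with he | he
      · exact he
      · exfalso
        rw [edge_adj] at he
        rcases he.1 with ⟨rfl, rfl⟩ | ⟨rfl, rfl⟩
        · exact hne rfl
        · exact hne Sym2.eq_swap
  intro a c hc
  by_cases he : s(u, v) ∈ c.edges
  · have hu := c.fst_mem_support_of_mem_edges he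
    have hc' := hc.rotate hu
    have he' : s(u, v) ∈ (c.rotate u hu).edges := (c.rotate_edges u hu).symm.mem_iff.1 he
    have hlen : (c.rotate u hu).length = c.length := by simp
    rw [← hlen]
    have hv := (c.rotate u hu).snd_mem_support_of_mem_edges he'
    generalize c.rotate u hu = d at *
    -- The cycle, started at `u`, is cut at `v` into two walks. As a trail it uses the new edge only
    -- once, so one of them lies in `G` and is longer than `g`.
    have hspec := d.take_spec hv
    have hnd : d.edges.Nodup := hc'.isTrail.edges_nodup
    have hl : d.length = (d.takeUntil v hv).length + (d.dropUntil v hv).length := by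
      rw [← Walk.length_append, hspec]
    rw [← hspec, Walk.edges_append, List.nodup_append] at hnd
    by_cases h1 : s(u, v) ∈ (d.takeUntil v hv).edges
    · have h2 : ∀ e ∈ (d.dropUntil v hv).edges, e ∈ G.edgeSet := fun e he =>
        hadj e (Walk.edges_subset_edgeSet _ he) fun h => hnd.2.2 _ h1 _ he h.symm
      have := hfar ((d.dropUntil v hv).transfer G h2).reverse
      simp at this
      omega
    · have h2 : ∀ e ∈ (d.takeUntil v hv).edges, e ∈ G.edgeSet := fun e he =>
        hadj e (Walk.edges_subset_edgeSet _ he) fun h => h1 (h ▸ he)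
      have := hfar ((d.takeUntil v hv).transfer G h2)
      simp at this
      omega
  · have h2 : ∀ e ∈ c.edges, e ∈ G.edgeSet := fun e he' =>
      hadj e (Walk.edges_subset_edgeSet _ he') fun h => he (h ▸ he')
    have := hG a (c.transfer G h2) (hc.transfer h2)
    simpa using this

end

section

open scoped Classical

variable {V : Type*} [Fintype V] {G : SimpleGraph V}

/-- The vertices reached from `u` by walks of length at most `r`. -/
noncomputable def walkBall (G : SimpleGraph V) (r : ℕ) (u : V) : Finset V :=
  Finset.univ.filter fun v => ∃ p : G.Walk u v, p.length ≤ r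

theorem card_walkBall_le {D : ℕ} (hD : ∀ v, G.degree v ≤ D) (r : ℕ) :
    ∀ u, (G.walkBall r u).card ≤ (D + 1) ^ r := by
  induction r with
  | zero =>
    intro u
    rw [pow_zero, Finset.card_le_one]
    intro a ha b hb
    simp only [walkBall, Finset.mem_filter, Finset.mem_univ, true_and, Nat.le_zero] at ha hb
    obtain ⟨p, hp⟩ := ha
    obtain ⟨q, hq⟩ := hb
    rw [← Walk.eq_of_length_eq_zero hp, ← Walk.eq_of_length_eq_zero hq]
  | succ r ih =>
    intro u
    have hsub : G.walkBall (r + 1) u ⊆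
        insert u ((G.neighborFinset u).biUnion fun w => G.walkBall r w) := by
      intro v hv
      simp only [walkBall, Finset.mem_filter, Finset.mem_univ, true_and, Finset.mem_insert,
        Finset.mem_biUnion, mem_neighborFinset] at hv ⊢
      obtain ⟨p, hp⟩ := hv
      cases p with
      | nil => exact Or.inl rfl
      | cons h p => exact Or.inr ⟨_, h, p, by simpa using hp⟩
    calc (G.walkBall (r + 1) u).card
        ≤ ((G.neighborFinset u).biUnion fun w => G.walkBall r w).card + 1 :=
          (Finset.card_le_card hsub).trans (Finset.card_insert_le _ _)
      _ ≤ G.degree u * (D + 1) ^ r + 1 := by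
          gcongr
          exact Finset.card_biUnion_le_card_mul _ _ _ fun w _ => ih w
      _ ≤ D * (D + 1) ^ r + (D + 1) ^ r := by
          gcongr
          · exact hD u
          · exact Nat.one_le_pow _ _ (by omega)
      _ = (D + 1) ^ (r + 1) := by ring

theorem neighborFinset_sup_edge_subset {G' : SimpleGraph V} {u v : V} (hG' : G' = G ⊔ edge u v)
    (w : V) : G'.neighborFinset w ⊆
      G.neighborFinset w ∪ ((if w = u then {v} else ∅) ∪ (if w = v then {u} else ∅)) := by
  intro x hx
  rw [mem_neighborFinset, hG', sup_adj, edge_adj] at hx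
  rcases hx with hx | ⟨⟨rfl, rfl⟩ | ⟨rfl, rfl⟩, -⟩
  · simp [hx]
  · simp
  · simp

theorem degree_sup_edge_le {G' : SimpleGraph V} {u v : V} (hG' : G' = G ⊔ edge u v) (w : V) :
    G'.degree w ≤ G.degree w + ((if w = u then 1 else 0) + if w = v then 1 else 0) := by
  refine (Finset.card_le_card (neighborFinset_sup_edge_subset hG' w)).trans
    ((Finset.card_union_le _ _).trans (add_le_add le_rfl ((Finset.card_union_le _ _).trans ?_)))
  split_ifs <;> simp

/-- The pairs of sets of `k` vertices of degree less than `D` that are not joined by an edge. -/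
noncomputable def emptyPairs (G : SimpleGraph V) (D k : ℕ) : Finset (Finset V × Finset V) :=
  Finset.univ.filter fun P => (P.1.card = k ∧ ∀ a ∈ P.1, G.degree a < D) ∧
    (P.2.card = k ∧ ∀ b ∈ P.2, G.degree b < D) ∧ ∀ a ∈ P.1, ∀ b ∈ P.2, ¬ G.Adj a b

/-- The pairs of distant vertices of degree less than `D`. -/
noncomputable def farPairs (G : SimpleGraph V) (D g : ℕ) : Finset (V × V) :=
  Finset.univ.filter fun e => G.degree e.1 < D ∧ G.degree e.2 < D ∧
    ∀ p : G.Walk e.1 e.2, g < p.length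

/-- The pair `e` has its components in the respective components of `P`. -/
def Crosses {V : Type*} (e : V × V) (P : Finset V × Finset V) : Prop :=
  e.1 ∈ P.1 ∧ e.2 ∈ P.2

/-- At most `(D + 1) ^ g ≤ k / 2` vertices are within distance `g` of a given one, so at least half
of the `k ^ 2` pairs are far. -/
theorem le_card_farPairs {D g k : ℕ} (hD : ∀ v, G.degree v ≤ D) (hk : 2 * (D + 1) ^ g ≤ k)
    {P : Finset V × Finset V} (hP : P ∈ G.emptyPairs D k) :
    k ^ 2 ≤ 2 * ((G.farPairs D g).filter fun e => Crosses e P).card := by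
  simp only [emptyPairs, Finset.mem_filter, Finset.mem_univ, true_and] at hP
  obtain ⟨⟨h1, h1'⟩, ⟨h2, h2'⟩, -⟩ := hP
  have hsub : P.1 ×ˢ P.2 ⊆ ((G.farPairs D g).filter fun e => Crosses e P) ∪
      P.1.biUnion fun a => (G.walkBall g a).image (Prod.mk a) := by
    rintro ⟨a, b⟩ hab
    rw [Finset.mem_product] at hab
    by_cases hfar : ∀ p : G.Walk a b, g < p.length
    · refine Finset.mem_union_left _ ?_
      simp only [farPairs, Finset.mem_filter, Finset.mem_univ, true_and]
      exact ⟨⟨h1' a hab.1, h2' b hab.2, hfar⟩, hab⟩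
    · refine Finset.mem_union_right _ ?_
      push Not at hfar
      simp only [Finset.mem_biUnion, Finset.mem_image, walkBall, Finset.mem_filter,
        Finset.mem_univ, true_and]
      exact ⟨a, hab.1, b, hfar, rfl⟩
  have hle := (Finset.card_le_card hsub).trans (Finset.card_union_le _ _)
  rw [Finset.card_product, h1, h2] at hle
  have h3 : (P.1.biUnion fun a => (G.walkBall g a).image (Prod.mk a)).card ≤ k * (D + 1) ^ g := by
    rw [← h1]
    exact Finset.card_biUnion_le_card_mul _ _ _ fun a _ =>
      Finset.card_image_le.trans (card_walkBall_le hD g a)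
  nlinarith

/-- Some admissible edge reduces the number of empty pairs by a constant factor. -/
theorem exists_sup_edge {D g k : ℕ} (hk0 : 0 < k) (hD : ∀ v, G.degree v ≤ D)
    (hG : G.NoShortCycle g) (hk : 2 * (D + 1) ^ g ≤ k) :
    ∃ G' : SimpleGraph V, (∀ v, G'.degree v ≤ D) ∧ G'.NoShortCycle g ∧
      ∑ v, G'.degree v ≤ ∑ v, G.degree v + 2 ∧
      (G'.emptyPairs D k).card * (2 * Fintype.card V ^ 2) + (G.emptyPairs D k).card * k ^ 2 ≤
        (G.emptyPairs D k).card * (2 * Fintype.card V ^ 2) := by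
  rcases (G.emptyPairs D k).eq_empty_or_nonempty with hE | ⟨P₀, hP₀⟩
  · exact ⟨G, hD, hG, by omega, by simp [hE]⟩
  have hcount := Finset.sum_card_bipartiteAbove_eq_sum_card_bipartiteBelow
    (s := G.farPairs D g) (t := G.emptyPairs D k) Crosses
  have hlow : (G.emptyPairs D k).card * k ^ 2 ≤ 2 * ∑ P ∈ G.emptyPairs D k,
      ((G.farPairs D g).bipartiteBelow Crosses P).card := by
    rw [Finset.mul_sum, ← smul_eq_mul]
    exact Finset.card_nsmul_le_sum _ _ _ fun P hP => le_card_farPairs hD hk hP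
  have hne : (G.farPairs D g).Nonempty := by
    rw [Finset.nonempty_iff_ne_empty]
    intro hF
    have h1 := le_card_farPairs hD hk hP₀
    rw [hF, Finset.filter_empty, Finset.card_empty] at h1
    have := pow_pos hk0 2
    omega
  -- Averaging: there are at most `Fintype.card V ^ 2` far pairs, and each empty pair is crossed by
  -- at least `k ^ 2 / 2` of them.
  obtain ⟨e, he, hkill⟩ := Finset.exists_le_of_sum_le hne
    (f := fun _ => (G.emptyPairs D k).card * k ^ 2)
    (g := fun e => 2 * Fintype.card V ^ 2 *
      ((G.emptyPairs D k).bipartiteAbove Crosses e).card) (by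
    rw [Finset.sum_const, smul_eq_mul, ← Finset.mul_sum, hcount]
    have hF : (G.farPairs D g).card ≤ Fintype.card V ^ 2 := by
      rw [pow_two, ← Fintype.card_prod]
      exact Finset.card_le_univ _
    calc _ ≤ Fintype.card V ^ 2 * (2 * ∑ P ∈ G.emptyPairs D k, _) := Nat.mul_le_mul hF hlow
      _ = _ := by ring)
  obtain ⟨u, v⟩ := e
  simp only [farPairs, Finset.mem_filter, Finset.mem_univ, true_and] at he
  obtain ⟨hu, hv, hfar⟩ := he
  have huv : u ≠ v := by
    rintro rfl
    simpa using hfar Walk.nil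
  have hnew := hG.sup_edge hfar
  obtain ⟨G', hG'⟩ : ∃ G', G' = G ⊔ edge u v := ⟨_, rfl⟩
  have hle : G ≤ G' := hG' ▸ le_sup_left
  rw [← hG'] at hnew
  have hdeg : ∀ w, G.degree w ≤ G'.degree w := fun w => degree_le_of_le hle
  refine ⟨G', fun w => ?_, hnew, ?_, ?_⟩
  · have h1 := degree_sup_edge_le hG' w
    have h2 := hD w
    by_cases hwu : w = u
    · subst hwu
      rw [if_pos rfl, if_neg huv] at h1
      omega
    · by_cases hwv : w = v
      · subst hwv
        rw [if_pos rfl, if_neg hwu] at h1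
        omega
      · rw [if_neg hwu, if_neg hwv] at h1
        omega
  · calc ∑ w, G'.degree w
        ≤ ∑ w, (G.degree w + ((if w = u then 1 else 0) + if w = v then 1 else 0)) :=
          Finset.sum_le_sum fun w _ => degree_sup_edge_le hG' w
      _ = ∑ w, G.degree w + 2 := by
          rw [Finset.sum_add_distrib, Finset.sum_add_distrib]
          simp
  · have hsub : G'.emptyPairs D k ⊆ G.emptyPairs D k \
        (G.emptyPairs D k).bipartiteAbove Crosses (u, v) := by
      intro P hP
      simp only [emptyPairs, Finset.mem_filter, Finset.mem_univ, true_and, Finset.mem_sdiff,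
        Finset.mem_bipartiteAbove, not_and] at hP ⊢
      obtain ⟨⟨h1, h1'⟩, ⟨h2, h2'⟩, h3⟩ := hP
      refine ⟨⟨⟨h1, fun a ha => (hdeg a).trans_lt (h1' a ha)⟩,
        ⟨h2, fun a ha => (hdeg a).trans_lt (h2' a ha)⟩,
        fun a ha b hb hab => h3 a ha b hb (hle hab)⟩, fun _ hc => h3 u hc.1 v hc.2 ?_⟩
      rw [hG']
      exact Or.inr ((edge_adj ..).2 ⟨Or.inl ⟨rfl, rfl⟩, huv⟩)
    have h1 := Finset.card_le_card hsub
    have h2 := Finset.card_sdiff_add_card_eq_card (t := G.emptyPairs D k)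
      (s := (G.emptyPairs D k).bipartiteAbove Crosses (u, v))
      (Finset.filter_subset _ _)
    calc _ ≤ _ := Nat.add_le_add_left hkill _
      _ = ((G'.emptyPairs D k).card + ((G.emptyPairs D k).bipartiteAbove Crosses (u, v)).card) *
          (2 * Fintype.card V ^ 2) := by ring
      _ ≤ _ := Nat.mul_le_mul_right _ (by omega)

theorem exists_graph_emptyPairs_le {D g k : ℕ} (hk0 : 0 < k) (hk : 2 * (D + 1) ^ g ≤ k)
    (hkV : k ≤ Fintype.card V) (t : ℕ) :
    ∃ G : SimpleGraph V, (∀ v, G.degree v ≤ D) ∧ G.NoShortCycle g ∧ ∑ v, G.degree v ≤ 2 * t ∧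
      ((G.emptyPairs D k).card : ℝ) ≤ ((Fintype.card V).choose k : ℝ) ^ 2 *
        (1 - (k : ℝ) ^ 2 / (2 * Fintype.card V ^ 2)) ^ t := by
  induction t with
  | zero =>
    refine ⟨⊥, by simp, noShortCycle_bot g, by simp, ?_⟩
    rw [pow_zero, mul_one]
    have hsub : (⊥ : SimpleGraph V).emptyPairs D k ⊆
        Finset.powersetCard k Finset.univ ×ˢ Finset.powersetCard k Finset.univ := by
      intro P hP
      simp only [emptyPairs, Finset.mem_filter, Finset.mem_univ, true_and] at hP
      simp [Finset.mem_powersetCard, hP.1.1, hP.2.1.1]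
    have h := Finset.card_le_card hsub
    rw [Finset.card_product, Finset.card_powersetCard, Finset.card_univ, ← pow_two] at h
    exact_mod_cast h
  | succ t ih =>
    obtain ⟨G, h1, h2, h3, h4⟩ := ih
    obtain ⟨G', h1', h2', h3', h4'⟩ := exists_sup_edge hk0 h1 h2 hk
    refine ⟨G', h1', h2', by omega, ?_⟩
    have hk' : (0 : ℝ) < k := by exact_mod_cast hk0
    have hkV' : (k : ℝ) ≤ Fintype.card V := by exact_mod_cast hkV
    have hV : (0 : ℝ) < 2 * Fintype.card V ^ 2 := by
      have := hk'.trans_le hkV'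
      positivity
    have hx : 0 ≤ 1 - (k : ℝ) ^ 2 / (2 * Fintype.card V ^ 2) := by
      rw [sub_nonneg, div_le_one hV]
      nlinarith
    have h5 : ((G'.emptyPairs D k).card : ℝ) * (2 * Fintype.card V ^ 2) +
        (G.emptyPairs D k).card * k ^ 2 ≤
          (G.emptyPairs D k).card * (2 * Fintype.card V ^ 2) := by exact_mod_cast h4'
    calc ((G'.emptyPairs D k).card : ℝ)
        ≤ (G.emptyPairs D k).card * (1 - (k : ℝ) ^ 2 / (2 * Fintype.card V ^ 2)) := by
          rw [mul_sub, mul_one, mul_div_assoc', le_sub_iff_add_le, ← le_sub_iff_add_le',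
            div_le_iff₀ hV]
          linarith
      _ ≤ _ := mul_le_mul_of_nonneg_right h4 hx
      _ = _ := by ring

/-- The number of pairs of `k`-element sets is small compared with the exponential decay of the
number of empty ones. -/
theorem choose_sq_mul_pow_lt_one {q c k : ℕ} (hq : 0 < q) (hk : 0 < k)
    (hc : 4 * q * (1 + Real.log q) < c) :
    ((q * k).choose k : ℝ) ^ 2 *
      (1 - (k : ℝ) ^ 2 / (2 * ((q * k : ℕ) : ℝ) ^ 2)) ^ (q * k * c) < 1 := by
  have hq' : (0 : ℝ) < q := by exact_mod_cast hq
  have hk' : (0 : ℝ) < k := by exact_mod_cast hk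
  have h1 : ((q * k).choose k : ℝ) ≤ Real.exp (k * (1 + Real.log q)) := by
    calc ((q * k).choose k : ℝ) ≤ ((q * k : ℕ) : ℝ) ^ k / (k.factorial : ℝ) :=
          Nat.choose_le_pow_div _ _
      _ = (q : ℝ) ^ k * ((k : ℝ) ^ k / k.factorial) := by push_cast; rw [mul_pow]; ring
      _ ≤ (q : ℝ) ^ k * Real.exp k := by
          gcongr
          exact Real.pow_div_factorial_le_exp _ hk'.le _
      _ = Real.exp (k * (1 + Real.log q)) := by
          rw [mul_add, mul_one, Real.exp_add, mul_comm (k : ℝ) (Real.log q), mul_comm,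
            Real.exp_mul, Real.exp_log hq', Real.rpow_natCast]
  have hx : (k : ℝ) ^ 2 / (2 * ((q * k : ℕ) : ℝ) ^ 2) = 1 / (2 * (q : ℝ) ^ 2) := by
    push_cast
    field_simp
  have hx1 : 1 / (2 * (q : ℝ) ^ 2) ≤ 1 := by
    have : (1 : ℝ) ≤ q := by exact_mod_cast hq
    rw [div_le_one (by positivity)]
    nlinarith
  have h2 : (1 - 1 / (2 * (q : ℝ) ^ 2)) ^ (q * k * c) ≤ Real.exp (-(k * c / (2 * q))) := by
    calc (1 - 1 / (2 * (q : ℝ) ^ 2)) ^ (q * k * c)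
        ≤ Real.exp (-(1 / (2 * (q : ℝ) ^ 2))) ^ (q * k * c) := by
          refine pow_le_pow_left₀ (by linarith) (Real.one_sub_le_exp_neg _) _
      _ = Real.exp (-(k * c / (2 * q))) := by
          rw [← Real.exp_nat_mul]
          congr 1
          push_cast
          field_simp
  rw [hx]
  calc ((q * k).choose k : ℝ) ^ 2 * (1 - 1 / (2 * (q : ℝ) ^ 2)) ^ (q * k * c)
      ≤ Real.exp (k * (1 + Real.log q)) ^ 2 * Real.exp (-(k * c / (2 * q))) := by
        gcongr
    _ = Real.exp (k * (2 * (1 + Real.log q) - c / (2 * q))) := by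
        rw [← Real.exp_nat_mul, ← Real.exp_add]
        congr 1
        push_cast
        ring
    _ < 1 := by
        rw [Real.exp_lt_one_iff]
        refine mul_neg_of_pos_of_neg hk' ?_
        rw [sub_neg, lt_div_iff₀ (by positivity)]
        linarith

/-- A graph without large independent sets is not a forest. -/
theorem Joined.not_isAcyclic {k : ℕ} (hG : G.Joined k) (hk : 2 * k ≤ Fintype.card V) :
    ¬ G.IsAcyclic := by
  intro hac
  -- A color class is independent, so it has fewer than `k` vertices.
  obtain ⟨C⟩ := hac.colorable_two
  have hind : ∀ i, (C.colorClass i).ncard < k := by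
    intro i
    by_contra hcon
    obtain ⟨a, ha, b, hb, hab⟩ := hG _ _ (not_lt.1 hcon) (not_lt.1 hcon)
    exact C.valid hab (ha.trans hb.symm)
  have hun : (Set.univ : Set V) = C.colorClass 0 ∪ C.colorClass 1 := by
    ext v
    have h : C v = 0 ∨ C v = 1 := by
      generalize C v = x
      fin_cases x <;> simp
    exact iff_of_true trivial h
  have hle := Set.ncard_union_le (C.colorClass 0) (C.colorClass 1)
  rw [← hun, Set.ncard_univ, Nat.card_eq_fintype_card] at hle
  have h0 := hind 0
  have h1 := hind 1
  omega

end

open scoped Classical in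
/-- There are sparse connected graphs of arbitrarily large girth in which any two sets with a
fraction `4 / q` of the vertices are joined by an edge. -/
theorem exists_sparse_joined {q c : ℕ} (hq : 12 ≤ q) (hc : 4 * q * (1 + Real.log q) < c)
    (g N : ℕ) : ∃ (k : ℕ) (V : Type) (_ : Fintype V) (H : SimpleGraph V), N ≤ k ∧ H.Connected ∧
      H.Joined k ∧ q * k ≤ 4 * Fintype.card V ∧ (∀ v, H.degree v ≤ 4 * c) ∧ H.NoShortCycle g ∧
      ¬ H.IsAcyclic := by
  have hc0 : 0 < c := by
    have h1 : (0 : ℝ) ≤ Real.log q := Real.log_natCast_nonneg q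
    have h2 : (0 : ℝ) < c := lt_of_le_of_lt (by positivity) hc
    exact_mod_cast h2
  obtain ⟨k, hNk, hk0, hk⟩ : ∃ k, N ≤ k ∧ 0 < k ∧ 2 * (4 * c + 1) ^ g ≤ k :=
    ⟨N + 2 * (4 * c + 1) ^ g, by omega, by positivity, by omega⟩
  obtain ⟨G, hdeg, hgirth, hsum, hbad⟩ := exists_graph_emptyPairs_le (V := Fin (q * k))
    (D := 4 * c) (g := g) hk0 hk (by simpa using Nat.le_mul_of_pos_left k (by omega)) (q * k * c)
  rw [Fintype.card_fin] at hbad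
  have hempty : G.emptyPairs (4 * c) k = ∅ := by
    have h1 := hbad.trans_lt (choose_sq_mul_pow_lt_one (by omega) hk0 hc)
    rw [← Finset.card_eq_zero]
    have : (G.emptyPairs (4 * c) k).card < 1 := by exact_mod_cast h1
    omega
  let U : Set (Fin (q * k)) := {v | G.degree v < 4 * c}
  have hjoin : ∀ A ⊆ U, ∀ B ⊆ U, k ≤ A.ncard → k ≤ B.ncard → ∃ a ∈ A, ∃ b ∈ B, G.Adj a b := by
    intro A hA B hB hAk hBk
    rw [Set.ncard_eq_toFinset_card'] at hAk hBk
    obtain ⟨A', hA', hA'k⟩ := Finset.exists_subset_card_eq hAk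
    obtain ⟨B', hB', hB'k⟩ := Finset.exists_subset_card_eq hBk
    by_contra hcon
    push Not at hcon
    have hA'' : ∀ a ∈ A', a ∈ A := fun a ha => Set.mem_toFinset.1 (hA' ha)
    have hB'' : ∀ b ∈ B', b ∈ B := fun b hb => Set.mem_toFinset.1 (hB' hb)
    have : (A', B') ∈ G.emptyPairs (4 * c) k := by
      simp only [emptyPairs, Finset.mem_filter, Finset.mem_univ, true_and]
      exact ⟨⟨hA'k, fun a ha => hA (hA'' a ha)⟩, ⟨hB'k, fun b hb => hB (hB'' b hb)⟩,
        fun a ha b hb => hcon a (hA'' a ha) b (hB'' b hb)⟩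
    simp [hempty] at this
  -- The degrees sum to at most `2 * (q * k * c)`, so at most half of the vertices have degree `4 *
  -- c` or more.
  have hU : q * k ≤ 2 * U.ncard := by
    have h1 : Uᶜ.ncard * (4 * c) ≤ 2 * (q * k * c) := by
      refine le_trans ?_ hsum
      rw [Set.ncard_eq_toFinset_card', ← smul_eq_mul]
      refine (Finset.card_nsmul_le_sum _ (fun v => G.degree v) _ fun v hv => ?_).trans
        (Finset.sum_le_sum_of_subset (Finset.subset_univ _))
      rw [Set.mem_toFinset] at hv
      exact not_lt.1 hv
    have h2 : 2 * Uᶜ.ncard ≤ q * k := by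
      refine Nat.le_of_mul_le_mul_right (c := 2 * c) ?_ (by omega)
      calc 2 * Uᶜ.ncard * (2 * c) = Uᶜ.ncard * (4 * c) := by ring
        _ ≤ 2 * (q * k * c) := h1
        _ = q * k * (2 * c) := by ring
    have h3 := Set.ncard_add_ncard_compl U
    rw [Nat.card_eq_fintype_card, Fintype.card_fin] at h3
    omega
  have hqk : 12 * k ≤ q * k := Nat.mul_le_mul_right k hq
  -- `C` has more than `q * k / 2 - k` vertices, which is at least `q * k / 4` because `12 ≤ q`.
  obtain ⟨C, hCU, hC, hCk⟩ := exists_linked_subset hk0 (U := U) (by omega) hjoin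
  have hCcard : Fintype.card C = C.ncard := by
    rw [Set.ncard_eq_toFinset_card', Set.toFinset_card]
  have hCne : C.Nonempty := by
    rw [Set.nonempty_iff_ne_empty]
    rintro rfl
    rw [Set.ncard_empty] at hCk
    omega
  have hJ : (G.induce C).Joined k := by
    intro A B hA hB
    rw [← Set.ncard_image_of_injective _ Subtype.val_injective] at hA hB
    obtain ⟨_, ⟨a, ha, rfl⟩, _, ⟨b, hb, rfl⟩, hab⟩ := hjoin (Subtype.val '' A)
      (by rintro _ ⟨a, _, rfl⟩; exact hCU a.2) (Subtype.val '' B)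
      (by rintro _ ⟨a, _, rfl⟩; exact hCU a.2) hA hB
    exact ⟨a, ha, b, hb, hab⟩
  refine ⟨k, C, inferInstance, G.induce C, hNk, ?_, hJ, by omega, fun v => ?_, ?_,
    hJ.not_isAcyclic (by omega)⟩
  · have := hCne.to_subtype
    exact ⟨(linked_iff_preconnected _ _).1 hC⟩
  · refine le_trans ?_ (hdeg v)
    rw [← card_neighborFinset_eq_degree, ← card_neighborFinset_eq_degree]
    refine Finset.card_le_card_of_injOn Subtype.val (fun w hw => ?_) Subtype.val_injective.injOn
    simpa using hw
  · intro v c hc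
    have h1 : (c.map (Embedding.induce C).toHom).IsCycle := hc.map Subtype.val_injective
    have h2 := hgirth _ _ h1
    rwa [Walk.length_map] at h2

end SimpleGraph

/-! ### Densities of shallow minors -/

namespace SimpleGraph

open scoped Classical in
theorem ncard_edgeSet_le_of_degree_le {m K : ℕ} {H : SimpleGraph (Fin m)}
    (hK : ∀ i, H.degree i ≤ K) : H.edgeSet.ncard ≤ m * K := by
  have h1 := H.sum_degrees_eq_twice_card_edges
  have h2 : ∑ i, H.degree i ≤ m * K := by
    simpa using Finset.sum_le_card_nsmul Finset.univ _ K fun i _ => hK i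
  rw [← coe_edgeFinset, Set.ncard_coe_finset]
  omega

open scoped Classical in
theorem gradLE_of_forall_degree_le {V : Type} {G : SimpleGraph V} {r K : ℕ}
    (h : ∀ (m : ℕ) (H : SimpleGraph (Fin m)), 0 < m → IsShallowMinor r H G → ∀ i, H.degree i ≤ K) :
    GradLE r G K := by
  intro m H hm hH
  rw [div_le_iff₀ (by exact_mod_cast hm)]
  have := ncard_edgeSet_le_of_degree_le (h m H hm hH)
  rw [mul_comm]
  exact_mod_cast this

open scoped Classical in
/-- The densities of shallow minors are bounded in terms of the maximum degree. -/
theorem gradLE_of_degree_le {V : Type} [Fintype V] {G : SimpleGraph V} {D : ℕ}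
    (hD : ∀ v, G.degree v ≤ D) (r : ℕ) : GradLE r G ((D + 1) ^ (r + 1) : ℕ) := by
  refine gradLE_of_forall_degree_le fun m H _ ⟨B, hB, hdisj, hadj⟩ i => ?_
  obtain ⟨c, hc⟩ := hB i
  -- Each neighbor `j` of `i` has a vertex of `B j` within `r + 1` steps of the center of `B i`;
  -- these vertices are distinct by disjointness.
  have hw : ∀ j, ∃ y, H.Adj i j → y ∈ B j ∧ y ∈ G.walkBall (r + 1) c := by
    intro j
    by_cases hij : H.Adj i j
    · obtain ⟨x, hx, y, hy, hxy⟩ := hadj i j hij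
      refine ⟨y, fun _ => ⟨hy, ?_⟩⟩
      have h1 := hc ⟨x, hx⟩
      obtain ⟨p, hp⟩ := exists_walk_of_edist_ne_top (ne_top_of_le_ne_top (ENat.natCast_ne_top r) h1)
      rw [← hp, Nat.cast_le] at h1
      simp only [walkBall, Finset.mem_filter, Finset.mem_univ, true_and]
      have hq : ∃ q : G.Walk c x, q.length = p.length :=
        ⟨p.map (Embedding.induce (B i)).toHom, Walk.length_map _ _⟩
      obtain ⟨q, hq⟩ := hq
      refine ⟨q.concat hxy, ?_⟩
      rw [Walk.length_concat]
      omega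
    · exact ⟨c, fun h => absurd h hij⟩
  choose f hf using hw
  refine le_trans ?_ (card_walkBall_le hD (r + 1) (c : V))
  rw [← card_neighborFinset_eq_degree]
  refine Finset.card_le_card_of_injOn f
    (fun j hj => (hf j ((mem_neighborFinset _ _ _).1 hj)).2) fun j hj j' hj' hjj' => ?_
  by_contra hne
  have h1 := (hf j ((mem_neighborFinset _ _ _).1 hj)).1
  have h2 := (hf j' ((mem_neighborFinset _ _ _).1 hj')).1
  exact Set.disjoint_left.1 (hdisj j j' hne) h1 (hjj' ▸ h2)

/-- The densities of shallow minors are bounded by the number of vertices. -/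
theorem gradLE_card {V : Type} [Fintype V] (G : SimpleGraph V) (r : ℕ) :
    GradLE r G (Fintype.card V) := by
  classical
  refine gradLE_of_forall_degree_le fun m H _ ⟨B, hB, hdisj, hadj⟩ i => ?_
  have hm : m ≤ Fintype.card V := by
    have h := Fintype.card_le_of_injective (fun i => ((hB i).choose : V)) (by
      intro i j hij
      by_contra hne
      have h2 : ((hB j).choose : V) ∈ B j := Subtype.property _
      refine Set.disjoint_left.1 (hdisj i j hne) (Subtype.property (hB i).choose) ?_
      dsimp only at hij
      rwa [hij])
    simpa using h
  exact (H.degree_lt_card_verts i).le.trans (by simpa using hm)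

/-! ### Balls in graphs of large girth -/

section

variable {V : Type*} {G : SimpleGraph V}

/-- In a forest paths are unique, so the union of `p` and `q` contains a cycle, whose edges are all
edges of `p` or `q`. -/
theorem NoShortCycle.le_length_add_length {g : ℕ} (hG : G.NoShortCycle g) {u v : V}
    {p q : G.Walk u v} (hp : p.IsPath) (hq : q.IsPath) (hpq : p ≠ q) :
    g ≤ p.length + q.length := by
  classical
  let G' : SimpleGraph V := fromEdgeSet {e | e ∈ p.edges ∨ e ∈ q.edges}
  have hle : G' ≤ G := by
    intro a b hab
    rcases ((fromEdgeSet_adj _).1 hab).1 with h | h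
    · exact p.adj_of_mem_edges h
    · exact q.adj_of_mem_edges h
  have hp' : ∀ e ∈ p.edges, e ∈ G'.edgeSet := fun e he => by
    rw [edgeSet_fromEdgeSet]
    exact ⟨Or.inl he, G.not_isDiag_of_mem_edgeSet (p.edges_subset_edgeSet he)⟩
  have hq' : ∀ e ∈ q.edges, e ∈ G'.edgeSet := fun e he => by
    rw [edgeSet_fromEdgeSet]
    exact ⟨Or.inr he, G.not_isDiag_of_mem_edgeSet (q.edges_subset_edgeSet he)⟩
  have hac : ¬ G'.IsAcyclic := by
    intro hac
    have h := (hac.subsingleton_path u v).elim ⟨p.transfer G' hp', hp.transfer hp'⟩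
      ⟨q.transfer G' hq', hq.transfer hq'⟩
    rw [Subtype.mk.injEq] at h
    apply hpq
    apply Walk.ext_support
    rw [← p.support_transfer hp', ← q.support_transfer hq', h]
  unfold IsAcyclic at hac
  push Not at hac
  obtain ⟨a, c, hc⟩ := hac
  have h1 := hG a (c.mapLe hle) (hc.mapLe hle)
  rw [Walk.length_map] at h1
  refine h1.trans ?_
  rw [← c.length_edges, ← List.toFinset_card_of_nodup hc.isTrail.edges_nodup]
  calc c.edges.toFinset.card ≤ (p.edges ++ q.edges).toFinset.card := by
        refine Finset.card_le_card fun e he => ?_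
        rw [List.mem_toFinset] at he ⊢
        have h2 := c.edges_subset_edgeSet he
        rw [edgeSet_fromEdgeSet] at h2
        exact List.mem_append.2 h2.1
    _ ≤ (p.edges ++ q.edges).length := List.toFinset_card_le _
    _ = p.length + q.length := by simp

/-- In a ball, a vertex has at most one neighbor that is not farther from the center. -/
theorem NoShortCycle.eq_of_adj_of_dist_le {g ρ : ℕ} (hG : G.NoShortCycle g) (hg : 2 * ρ + 2 < g)
    {v u y z : V} (hu : G.edist v u ≤ ρ) (hy : G.Adj u y) (hz : G.Adj u z)
    (hyd : G.dist v y ≤ G.dist v u) (hzd : G.dist v z ≤ G.dist v u) : y = z := by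
  classical
  have hr : G.Reachable v u :=
    reachable_of_edist_ne_top (ne_top_of_le_ne_top (ENat.natCast_ne_top ρ) hu)
  rw [← hr.coe_dist_eq_edist, Nat.cast_le] at hu
  -- A shortest path to `y` avoids `u`, since its part up to `u` would be too short. Adding the edge
  -- to `u` keeps it a path, of length at most `ρ + 1`.
  have key : ∀ y, G.Adj u y → G.dist v y ≤ G.dist v u →
      ∃ p : G.Walk v y, p.length = G.dist v y ∧ p.IsPath ∧ u ∉ p.support := by
    intro y hy hyd
    obtain ⟨p, hp, hpl⟩ := (hr.trans hy.reachable).exists_path_of_dist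
    refine ⟨p, hpl, hp, fun h => ?_⟩
    have h1 := Walk.length_takeUntil_lt_length h hy.ne
    have h2 := G.dist_le (p.takeUntil u h)
    omega
  obtain ⟨p, hpl, hp, hup⟩ := key y hy hyd
  obtain ⟨q, hql, hq, huq⟩ := key z hz hzd
  by_contra hne
  have h1 := hG.le_length_add_length (hp.concat hup hy.symm) (hq.concat huq hz.symm)
    (fun h => hne (Walk.concat_inj h).choose)
  rw [Walk.length_concat, Walk.length_concat] at h1
  omega

/-- Suppose that each vertex has at most one neighbor that is not higher. Then a path that starts
by leaving this neighbor behind ends in a vertex whose such neighbor is on the path. -/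
theorem exists_lower_mem_support {d : V → ℕ}
    (hd : ∀ x y z, G.Adj x y → G.Adj x z → d y ≤ d x → d z ≤ d x → y = z) {a b : V}
    (p : G.Walk a b) : p.IsPath → ∀ c, G.Adj a c → d c ≤ d a → c ∉ p.support →
      a = b ∨ ∃ z ∈ p.support, G.Adj b z ∧ d z ≤ d b := by
  induction p with
  | nil => exact fun _ _ _ _ _ => Or.inl rfl
  | @cons a a' b h p ih =>
    intro hp c hac hc hcp
    right
    rw [Walk.cons_isPath_iff] at hp
    -- The one neighbor of `a` that is not higher is off the path, so the path ascends and `a` plays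
    -- the same role for `a'`.
    have ha' : d a < d a' := by
      by_contra hcon
      have := hd a a' c h hac (not_lt.1 hcon) hc
      subst this
      exact hcp (by simp)
    rcases ih hp.1 a h.symm ha'.le hp.2 with rfl | ⟨z, hz, hbz⟩
    · exact ⟨a, by simp, h.symm, ha'.le⟩
    · exact ⟨z, by simp [hz], hbz⟩

/-- A path inside `B` from `x` to another vertex `x'` leaves `y` behind, so it ascends and contains
the lower neighbor of `x'`. Thus at most one vertex of `B` has its lower neighbor outside `B`. -/
theorem eq_of_lower_notMem {d : V → ℕ}
    (hd : ∀ x y z, G.Adj x y → G.Adj x z → d y ≤ d x → d z ≤ d x → y = z) {B : Set V}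
    (hB : (G.induce B).Preconnected) {x x' y y' : V} (hx : x ∈ B) (hx' : x' ∈ B)
    (hxy : G.Adj x y) (hy : d y ≤ d x) (hyB : y ∉ B) (hxy' : G.Adj x' y') (hy' : d y' ≤ d x')
    (hyB' : y' ∉ B) : y = y' := by
  classical
  obtain ⟨p, hp⟩ := (hB ⟨x, hx⟩ ⟨x', hx'⟩).exists_isPath
  have hsupp : ∀ z ∈ (p.map (Embedding.induce B).toHom).support, z ∈ B := by
    intro z hz
    rw [Walk.support_map, List.mem_map] at hz
    obtain ⟨w, -, rfl⟩ := hz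
    exact w.2
  have hp' : (p.map (Embedding.induce B).toHom).IsPath := hp.map Subtype.val_injective
  rcases exists_lower_mem_support hd _ hp' y hxy hy (fun h => hyB (hsupp y h)) with h | ⟨z, hz, h⟩
  · have hxx' : x = x' := h
    subst hxx'
    exact hd x y y' hxy hxy' hy hy'
  · have := hd x' z y' h.1 hxy' h.2 hy'
    exact absurd (this ▸ hsupp z hz) hyB'

end

/-- If each vertex has at most one neighbor that is not higher, then the minors have at most as many
edges as vertices. -/
theorem gradLE_one_of_lower {V : Type} {G : SimpleGraph V} {d : V → ℕ}
    (hd : ∀ x y z, G.Adj x y → G.Adj x z → d y ≤ d x → d z ≤ d x → y = z) (r : ℕ) :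
    GradLE r G 1 := by
  classical
  rintro m H hm ⟨B, hB, hdisj, hadj⟩
  rw [div_le_one (by exact_mod_cast hm), Nat.cast_le]
  have hconn : ∀ i, (G.induce (B i)).Preconnected := by
    intro i x y
    obtain ⟨c, hc⟩ := hB i
    have h : ∀ x, (G.induce (B i)).Reachable c x := fun x =>
      reachable_of_edist_ne_top (ne_top_of_le_ne_top (ENat.natCast_ne_top r) (hc x))
    exact (h x).symm.trans (h y)
  -- Each edge of `H` is oriented along a non-ascending edge of `G`; the out-degrees are then at
  -- most `1`.
  let E : Fin m → Fin m → Prop := fun i j =>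
    i ≠ j ∧ ∃ x ∈ B i, ∃ y ∈ B j, G.Adj x y ∧ d y ≤ d x
  have hE : ∀ i j j', E i j → E i j' → j = j' := by
    rintro i j j' ⟨hij, x, hx, y, hy, hxy, hle⟩ ⟨hij', x', hx', y', hy', hxy', hle'⟩
    by_contra hne
    have := eq_of_lower_notMem hd (hconn i) hx hx' hxy hle
      (fun h => Set.disjoint_left.1 (hdisj i j hij) h hy) hxy' hle'
      (fun h => Set.disjoint_left.1 (hdisj i j' hij') h hy')
    exact Set.disjoint_left.1 (hdisj j j' hne) hy (this ▸ hy')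
  have hφ : ∀ i, ∃ k, ∀ j, E i j → j = k := by
    intro i
    by_cases h : ∃ j, E i j
    · obtain ⟨j, hj⟩ := h
      exact ⟨j, fun j' hj' => hE i j' j hj' hj⟩
    · exact ⟨i, fun j hj => absurd ⟨j, hj⟩ h⟩
  choose φ hφ using hφ
  have hsub : H.edgeSet ⊆ ((Finset.univ.image fun i => s(i, φ i) : Finset (Sym2 (Fin m))) :
      Set (Sym2 (Fin m))) := by
    intro e
    induction e with
    | _ i j =>
      intro he
      rw [mem_edgeSet] at he
      rw [Finset.mem_coe, Finset.mem_image]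
      obtain ⟨x, hx, y, hy, hxy⟩ := hadj i j he
      rcases le_total (d y) (d x) with h | h
      · exact ⟨i, Finset.mem_univ _, by rw [← hφ i j ⟨he.ne, x, hx, y, hy, hxy, h⟩]⟩
      · refine ⟨j, Finset.mem_univ _, ?_⟩
        rw [← hφ j i ⟨he.ne', y, hy, x, hx, hxy.symm, h⟩]
        exact Sym2.eq_swap
  calc H.edgeSet.ncard ≤ _ := Set.ncard_le_ncard hsub (Finset.finite_toSet _)
    _ ≤ m := by
      rw [Set.ncard_coe_finset]
      exact Finset.card_image_le.trans (by simp)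

theorem NoShortCycle.gradLE_ballGraph {V : Type} {G : SimpleGraph V} {g ρ : ℕ}
    (hG : G.NoShortCycle g) (hg : 2 * ρ + 2 < g) (v : V) (r : ℕ) :
    GradLE r (ballGraph G ρ v) 1 :=
  gradLE_one_of_lower (G := ballGraph G ρ v) (d := fun x => G.dist v x)
    (fun x _ _ hy hz hyd hzd => Subtype.ext (hG.eq_of_adj_of_dist_le hg x.2 hy hz hyd hzd)) r

/-! ### Degrees and cycles of coronas -/

section

variable {V : Type} {H : SimpleGraph V}

open scoped Classical in
theorem degree_corona_le [Fintype V] {D : ℕ} (hD : ∀ v, H.degree v ≤ D) (x : V × Bool) :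
    H.corona.degree x ≤ D + 1 := by
  obtain ⟨v, b⟩ := x
  rw [← card_neighborFinset_eq_degree]
  cases b
  · have hsub : H.corona.neighborFinset (v, false) ⊆
        insert (v, true) ((H.neighborFinset v).image fun w => (w, false)) := by
      rintro ⟨w, b⟩ hw
      rw [mem_neighborFinset] at hw
      cases b
      · rw [corona_adj_false] at hw
        simp [hw]
      · have h := corona_adj_true.1 hw.symm
        simp only [Prod.mk.injEq, and_true] at h
        simp [h]
    refine (Finset.card_le_card hsub).trans ((Finset.card_insert_le _ _).trans ?_)
    gcongr
    exact Finset.card_image_le.trans (hD v)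
  · have hsub : H.corona.neighborFinset (v, true) ⊆ {(v, false)} := by
      intro y hy
      rw [mem_neighborFinset, corona_adj_true] at hy
      simp [hy]
    exact (Finset.card_le_card hsub).trans (by simp)

/-- A vertex of a cycle has two neighbors on it, so cycles avoid the leaves. -/
theorem NoShortCycle.corona {g : ℕ} (hH : H.NoShortCycle g) : H.corona.NoShortCycle g := by
  intro x c hc
  have hcore : ∀ y ∈ c.support, y ∈ {y : V × Bool | y.2 = false} := by
    rintro ⟨v, b⟩ hy
    cases b
    · rfl
    · have h1 := hc.ncard_neighborSet_toSubgraph_eq_two hy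
      have h2 : c.toSubgraph.neighborSet (v, true) ⊆ {(v, false)} := fun y hy =>
        corona_adj_true.1 (c.toSubgraph.adj_sub hy)
      have h3 := Set.ncard_le_ncard h2 (Set.finite_singleton _)
      rw [Set.ncard_singleton] at h3
      omega
  have h1 : ((c.induce _ hcore).map (Embedding.induce _).toHom).IsCycle := by
    rwa [Walk.map_induce]
  let f : H.corona.induce {y : V × Bool | y.2 = false} →g H :=
    ⟨fun y => y.1.1, fun {a b} hab => hab.elim (fun h => h.2.2)
      fun h => absurd (a.2.trans b.2.symm) h.2⟩
  have hf : Function.Injective f := fun a b hab =>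
    Subtype.ext (Prod.ext hab (a.2.trans b.2.symm))
  have h2 := hH _ _ (h1.of_map.map hf)
  rw [Walk.length_map] at h2
  have h3 := congrArg Walk.length (c.map_induce hcore)
  rw [Walk.length_map] at h3
  exact h2.trans_eq h3

theorem not_isAcyclic_corona (hH : ¬ H.IsAcyclic) : ¬ H.corona.IsAcyclic := fun h =>
  hH (h.comap ⟨fun v => (v, false), fun hab => corona_adj_false.2 hab⟩
    fun _ _ hab => (Prod.mk.inj hab).1)

theorem NoShortCycle.le_girth {g : ℕ} (hH : H.NoShortCycle g) (hac : ¬ H.IsAcyclic) :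
    g ≤ H.girth := by
  obtain ⟨a, w, hw, h⟩ := exists_girth_eq_length.2 hac
  rw [h]
  exact hH a w hw

end

end SimpleGraph

/-! ### The classes of graphs -/

theorem GradLE.mono {V : Type} {G : SimpleGraph V} {r : ℕ} {c c' : ℝ} (h : GradLE r G c)
    (hc : c ≤ c') : GradLE r G c' :=
  fun m H hm hH => (h m H hm hH).trans hc

theorem WeightedGraph.Secures.mono {A : WeightedGraph} {p : Player} {x y : ℝ}
    (h : A.Secures p y) (hxy : x ≤ y) : A.Secures p x :=
  let ⟨σ, hσ, hy⟩ := h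
  ⟨σ, hσ, fun l h1 h2 h3 => hxy.trans (hy l h1 h2 h3)⟩

open scoped Classical in
theorem exists_weightedGraph {q c : ℕ} (hq : 12 ≤ q) (hc : 4 * q * (1 + Real.log q) < c) (g : ℕ) :
    ∃ A : WeightedGraph, A.IsZeroOne ∧ Even A.order ∧ 0 < A.totalWeight ∧ g ≤ A.graph.girth ∧
      A.graph.NoShortCycle g ∧ g ≤ A.order ∧ (∀ v, A.graph.degree v ≤ 4 * c + 1) ∧
      A.Secures Player.bob ((1 - 36 / q) * A.totalWeight) := by
  -- The bound `g + 2 ≤ k` provides both `1 < k` and the order.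
  obtain ⟨k, V, _, H, hk, hconn, hJ, hcard, hdeg, hgirth, hac⟩ :=
    SimpleGraph.exists_sparse_joined hq hc g (g + 2)
  have h12 : 12 * k ≤ q * k := Nat.mul_le_mul_right k hq
  refine ⟨.corona H hconn, WeightedGraph.corona_isZeroOne, ?_, ?_,
    hgirth.corona.le_girth (SimpleGraph.not_isAcyclic_corona hac), hgirth.corona, ?_,
    fun v => ?_, ?_⟩
  · rw [WeightedGraph.corona_order]
    exact even_two.mul_left _
  · rw [WeightedGraph.corona_totalWeight, Nat.cast_pos]
    omega
  · rw [WeightedGraph.corona_order]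
    omega
  · exact SimpleGraph.degree_corona_le hdeg v
  · refine (WeightedGraph.secures_bob_corona (by omega) hJ).mono ?_
    rw [WeightedGraph.corona_totalWeight, sub_mul, one_mul]
    have h1 : (q : ℝ) * k ≤ 4 * Fintype.card V := by exact_mod_cast hcard
    have h2 : (0 : ℝ) < q := by exact_mod_cast (by omega : 0 < q)
    have h3 : 9 * (k : ℝ) ≤ 36 / q * Fintype.card V := by
      rw [div_mul_eq_mul_div, le_div_iff₀ h2]
      linarith
    linarith

/-- The reciprocal of the fraction of vertices contained in the sets that have to be joined. -/
noncomputable def reciprocal (ε : ℝ) : ℕ := max 12 ⌈9 / ε⌉₊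

/-- The number of edges, per vertex, that suffice to join all pairs of sets with a fraction `1 / q`
of the vertices. -/
noncomputable def density (q : ℕ) : ℕ := ⌊4 * q * (1 + Real.log q)⌋₊ + 1

theorem lt_density (q : ℕ) : 4 * q * (1 + Real.log q) < density q := by
  have := Nat.lt_floor_add_one (4 * q * (1 + Real.log q))
  unfold density
  exact_mod_cast this

theorem div_reciprocal_le {ε : ℝ} (hε : 0 < ε) : 36 / (reciprocal ε : ℝ) ≤ 4 * ε := by
  have h1 : 9 / ε ≤ reciprocal ε :=
    (Nat.le_ceil _).trans (by exact_mod_cast le_max_right _ _)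
  have h2 : (0 : ℝ) < reciprocal ε := lt_of_lt_of_le (by positivity) h1
  rw [div_le_iff₀ hε] at h1
  rw [div_le_iff₀ h2]
  linarith

theorem isBigO_density :
    (fun ε => ((4 * density (reciprocal ε) + 1 : ℕ) : ℝ)) =O[𝓝[>] 0]
      fun ε => 1 / ε * Real.log (1 / ε) := by
  -- With `L = x * log x ≥ 1`, the density is at most `4 * 22 * 23 * L + 1 = 2024 * L + 1`, and `4 *
  -- (2024 * L + 1) + 1 ≤ 8101 * L`.
  refine IsBigO.of_bound 8101 ?_
  filter_upwards [Ioo_mem_nhdsGT (Real.exp_pos (-1))] with ε ⟨hε, hε'⟩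
  obtain ⟨x, hx⟩ : ∃ x, x = 1 / ε := ⟨_, rfl⟩
  have hx0 : 0 < x := hx ▸ by positivity
  have hlog : 1 < Real.log x := by
    rw [hx, one_div, Real.log_inv]
    have := (Real.log_lt_log hε hε').trans_eq (Real.log_exp _)
    linarith
  have hx1 : 1 < x := by
    have := Real.log_le_sub_one_of_pos hx0
    linarith
  have hq : (reciprocal ε : ℝ) ≤ 22 * x := by
    unfold reciprocal
    rw [Nat.cast_max]
    refine max_le (by push_cast; linarith) ?_
    have := Nat.ceil_lt_add_one (show 0 ≤ 9 / ε by positivity)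
    rw [div_eq_mul_one_div, ← hx] at this ⊢
    linarith
  have hq0 : (0 : ℝ) < reciprocal ε := by
    have : 0 < reciprocal ε := lt_of_lt_of_le (by norm_num) (le_max_left _ _)
    exact_mod_cast this
  have hlogq : 1 + Real.log (reciprocal ε) ≤ 23 * Real.log x := by
    have h1 := Real.log_le_log hq0 hq
    rw [Real.log_mul (by norm_num) hx0.ne'] at h1
    have h2 := Real.log_le_sub_one_of_pos (show (0 : ℝ) < 22 by norm_num)
    linarith
  have hlogq0 : 0 ≤ 1 + Real.log (reciprocal ε) := by
    have := Real.log_natCast_nonneg (reciprocal ε)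
    linarith
  have hd : (density (reciprocal ε) : ℝ) ≤ 2024 * (x * Real.log x) + 1 := by
    unfold density
    have h1 := Nat.floor_le (show 0 ≤ 4 * (reciprocal ε : ℝ) * (1 + Real.log (reciprocal ε)) by
      positivity)
    have h2 : 4 * (reciprocal ε : ℝ) * (1 + Real.log (reciprocal ε)) ≤
        4 * (22 * x) * (23 * Real.log x) := by gcongr
    push_cast
    linarith
  have hxl : 1 ≤ x * Real.log x := by nlinarith
  rw [← hx, Real.norm_of_nonneg (Nat.cast_nonneg _), Real.norm_of_nonneg (by linarith)]
  push_cast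
  linarith

theorem exists_class_of_boundedExpansion {ε : ℝ} (hε : 0 < ε) :
    ∃ 𝒢 : Set WeightedGraph,
      (∀ A ∈ 𝒢, A.IsZeroOne ∧ Even A.order ∧ 0 < A.totalWeight ∧
        A.Secures Player.bob ((1 - 4 * ε) * A.totalWeight) ∧
        (A.maxDegree : ℝ) ≤ (4 * density (reciprocal ε) + 1 : ℕ)) ∧
      (∀ N : ℕ, ∃ A ∈ 𝒢, N ≤ A.order) ∧
      (∀ g : ℕ, ∃ A ∈ 𝒢, g ≤ A.graph.girth) ∧
      HasBoundedExpansion 𝒢 := by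
  classical
  choose A h1 h2 h3 h4 _ h6 h7 h8 using
    exists_weightedGraph (le_max_left 12 ⌈9 / ε⌉₊) (lt_density (reciprocal ε))
  refine ⟨Set.range A, ?_, fun N => ⟨_, ⟨N, rfl⟩, h6 N⟩, fun g => ⟨_, ⟨g, rfl⟩, h4 g⟩,
    fun r => ((4 * density (reciprocal ε) + 1 + 1) ^ (r + 1) : ℕ), ?_⟩
  · rintro _ ⟨g, rfl⟩
    refine ⟨h1 g, h2 g, h3 g, (h8 g).mono ?_, ?_⟩
    · exact mul_le_mul_of_nonneg_right (sub_le_sub_left (div_reciprocal_le hε) 1) (h3 g).le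
    · rw [Nat.cast_le]
      refine SimpleGraph.maxDegree_le_of_forall_degree_le _ _ fun v => ?_
      convert h7 g v
  · rintro _ ⟨g, rfl⟩ r
    refine SimpleGraph.gradLE_of_degree_le (fun v => ?_) r
    convert h7 g v

theorem exists_class_of_boundedLocalExpansion :
    ∃ 𝒢 : Set WeightedGraph,
      (∀ A ∈ 𝒢, A.IsZeroOne ∧ Even A.order ∧ 0 < A.totalWeight) ∧
      HasBoundedLocalExpansion 𝒢 ∧
      IsGLB ((fun A : WeightedGraph => A.aliceGain / A.totalWeight) '' 𝒢) 0 := by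
  classical
  choose A h1 h2 h3 _ h5 _ _ h8 using fun j : ℕ =>
    exists_weightedGraph (Nat.le_add_left 12 j) (lt_density (j + 12)) j
  refine ⟨Set.range A, ?_, ?_, ?_, ?_⟩
  · rintro _ ⟨j, rfl⟩
    exact ⟨h1 j, h2 j, h3 j⟩
  -- The `1` serves the graphs of girth above `2 * ρ + 2`; the sum of orders covers the finitely
  -- many others.
  · refine ⟨fun ρ _ => 1 + ∑ j ∈ Finset.range (2 * ρ + 3), ((A j).order : ℝ), ?_⟩
    rintro _ ⟨j, rfl⟩ ρ r v
    have hnonneg : ∀ i ∈ Finset.range (2 * ρ + 3), (0 : ℝ) ≤ (A i).order :=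
      fun i _ => Nat.cast_nonneg _
    by_cases hj : 2 * ρ + 2 < j
    · exact ((h5 j).gradLE_ballGraph hj v r).mono
        (le_add_of_nonneg_right (Finset.sum_nonneg hnonneg))
    · refine (SimpleGraph.gradLE_card (ballGraph (A j).graph ρ v) r).mono ?_
      have hle : (Fintype.card {u : (A j).V | (A j).graph.edist v u ≤ ρ} : ℝ) ≤ (A j).order := by
        exact_mod_cast Fintype.card_subtype_le _
      have hle' := Finset.single_le_sum hnonneg (Finset.mem_range.2 (show j < 2 * ρ + 3 by omega))
      linarith
  · rintro _ ⟨_, ⟨j, rfl⟩, rfl⟩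
    exact div_nonneg (WeightedGraph.aliceGain_nonneg (h8 j)) (h3 j).le
  · intro b hb
    by_contra hb0
    rw [not_le] at hb0
    obtain ⟨j, hj⟩ := exists_nat_gt (36 / b)
    have hbj : b ≤ (A j).aliceGain / (A j).totalWeight := hb ⟨A j, ⟨j, rfl⟩, rfl⟩
    rw [le_div_iff₀ (h3 j)] at hbj
    have hle := WeightedGraph.aliceGain_le (h8 j)
    have hj0 : (0 : ℝ) < (j + 12 : ℕ) := by positivity
    have h36 : 36 / ((j + 12 : ℕ) : ℝ) < b := by
      rw [div_lt_iff₀ hb0] at hj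
      rw [div_lt_iff₀ hj0]
      push_cast
      nlinarith
    have := mul_lt_mul_of_pos_right h36 (h3 j)
    linarith

/-- Since `girth` is `0` for forests, `g ≤ girth` with `g ≥ 1` also asserts that there is a cycle.
-/
theorem theorem2 :
    (∀ ε : ℝ, 0 < ε → ∀ g : ℕ, ∃ A : WeightedGraph,
      A.IsZeroOne ∧ Even A.order ∧ 0 < A.totalWeight ∧ g ≤ A.graph.girth ∧
      A.Secures Player.bob ((1 - 4 * ε) * A.totalWeight)) ∧
    (∃ D : ℝ → ℝ, (D =O[𝓝[>] 0] fun ε => 1 / ε * Real.log (1 / ε)) ∧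
      ∀ ε : ℝ, 0 < ε → ∃ 𝒢 : Set WeightedGraph,
        (∀ A ∈ 𝒢, A.IsZeroOne ∧ Even A.order ∧ 0 < A.totalWeight ∧
          A.Secures Player.bob ((1 - 4 * ε) * A.totalWeight) ∧ (A.maxDegree : ℝ) ≤ D ε) ∧
        (∀ N : ℕ, ∃ A ∈ 𝒢, N ≤ A.order) ∧
        (∀ g : ℕ, ∃ A ∈ 𝒢, g ≤ A.graph.girth) ∧
        HasBoundedExpansion 𝒢) ∧
    (∃ 𝒢 : Set WeightedGraph,
      (∀ A ∈ 𝒢, A.IsZeroOne ∧ Even A.order ∧ 0 < A.totalWeight) ∧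
      HasBoundedLocalExpansion 𝒢 ∧
      IsGLB ((fun A : WeightedGraph => A.aliceGain / A.totalWeight) '' 𝒢) 0) := by
  refine ⟨fun ε hε g => ?_, ⟨_, isBigO_density, fun ε hε => exists_class_of_boundedExpansion hε⟩,
    exists_class_of_boundedLocalExpansion⟩
  obtain ⟨𝒢, h1, -, h2, -⟩ := exists_class_of_boundedExpansion hε
  obtain ⟨A, hA, hg⟩ := h2 g
  obtain ⟨h3, h4, h5, h6, -⟩ := h1 A hA
  exact ⟨A, h3, h4, h5, hg, h6⟩
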